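/- Let $p$ be a prime. For $n\ge 1$ let $$f(X)=\xi_0+\xi_1X+\dots+\xi_{n-1}X^{n-1}+X^n,$$ where $\xi_0,\dots,\xi_{n-1}$ are independent, identically distributed random variables with values in the ring $\mathbb{Z}_p$ of $p$-adic integers (measurable for the Borel $\sigma$-algebra), and let $C_{\mathbb{Q}_p}(f)=\#\{x\in\mathbb{Q}_p : f(x)=0\}$ be the number of roots of $f$ in the field $\mathbb{Q}_p$ of $p$-adic numbers, counted without multiplicities. Let $\varepsilon>0$. In each of the following cases $C_{\mathbb{Q}_p}(f)$ is integrable, and as $n\to\infty$: 1. if $p>2$ and each $\xi_i$ takes the values $1$ and $-1$ with probability $1/2$ each, then $$\mathbb{E}\bigl[C_{\mathbb{Q}_p}(f)\bigr]=\frac{p-1}{p+1}+O\bigl(n^{-1/4+\varepsilon}\bigr);$$ 2. if each $\xi_i$ takes the values $0$ and $1$ with probability $1/2$ each, then $$\mathbb{E}\bigl[C_{\mathbb{Q}_p}(f)\bigr]=\frac{3p-1}{2(p+1)}+O\bigl(n^{-1/4+\varepsilon}\bigr);$$ 3. if each $\xi_i$ is uniformly distributed on $\{0,1,\dots,p-1\}$,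 then $$\mathbb{E}\bigl[C_{\mathbb{Q}_p}(f)\bigr]=\frac{p^2+1}{p(p+1)}+O\bigl(n^{-1/4+\varepsilon}\bigr).$$ In each case the implied constant depends only on $p$ and $\varepsilon$, and the bound holds for all $n\ge 1$. -/

import Mathlib

open MeasureTheory ProbabilityTheory Polynomial
open scoped ENNReal

universe u

/-- The Borel σ-algebra on the ring of `p`-adic integers. -/
noncomputable instance PadicInt.instMeasurableSpaceBorel (p : ℕ) [Fact p.Prime] : MeasurableSpace ℤ_[p] :=
  borel ℤ_[p]

instance PadicInt.instBorelSpaceBorel (p : ℕ) [Fact p.Prime] : BorelSpace ℤ_[p] :=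
  ⟨rfl⟩

/-- The number of roots of `f` in the field `F`, counted without multiplicities. -/
noncomputable def rootCount {F : Type*} [Field F] (f : F[X]) : ℕ :=
  {x : F | f.eval x = 0}.ncard

/-- The monic polynomial `a₀ + a₁ X + ⋯ + aₙ₋₁ X ^ (n - 1) + X ^ n` over `ℚ_p`,
with coefficients `aᵢ` in `ℤ_p`. -/
noncomputable def monicPoly {p : ℕ} [Fact p.Prime] {n : ℕ} (a : Fin n → ℤ_[p]) : ℚ_[p][X] :=
  (∑ i : Fin n, C (a i : ℚ_[p]) * X ^ (i : ℕ)) + X ^ n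

/-- The number of `p`-adic roots of the random monic polynomial with random coefficients
`ξ₀, …, ξₙ₋₁` in `ℤ_p`, as a real random variable. -/
noncomputable def randomRootCount {p : ℕ} [Fact p.Prime] {n : ℕ} {Ω : Type*}
    (ξ : Fin n → Ω → ℤ_[p]) (ω : Ω) : ℝ :=
  rootCount (monicPoly (fun i => ξ i ω))

/-!
The coefficients take finitely many values, so expectations are averages over `coeffBox A n`, where
`A ⊆ ℤ_p` is the set of values. In all three cases the elements of `A` are distinct modulo `p` and
each is `0` or a unit. As `f` is monic, its roots in `ℚ_p` lie in `ℤ_p`, and since the lowest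
nonzero coefficient is a unit, a root is either `0`, which happens when `ξ₀ = 0`, or a unit. It
remains to see that the expected number of unit roots is `(p - 1) / (p + 1) + O(n ^ (-1/4 + ε))`.

Sort the unit roots by the valuation `j` of `f'` at the root. By Hensel's lemma the number at
level `j` equals the number of residues `r` modulo `p ^ (j + 1)`, prime to `p`, with
`p ^ (2 j + 1) ∣ f(r)` and `f'(r)` of valuation exactly `j` (`card_unitRootsOfLevel`). If
`(f(r), f'(r))` were uniform, the expected number would be `(p - 1) ^ 2 / p ^ (2 j + 2)`, and these
numbers add up to `(p - 1) / (p + 1)`.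

The uniformity up to a tiny error is `abs_boxProb_divisibleAt_sub_le`, by Fourier analysis
modulo `p ^ m`. A nontrivial Fourier coefficient of the law of `(f(r), f'(r))` is a product over the
coefficients. The vectors `(r ^ i, i r ^ (i - 1))` through which `ξ_i` enters are periodic in `i`
with period `T = (p - 1) p ^ m`; they are `(1, 0)` for `i ≡ 0` and `(r, 1)` for `i ≡ 1`, so in every
period at least one factor is the average over `A` of a character separating two of its points, and
such a factor is at most `1 - c p ^ (-2 m)`. The product is then at most `exp (- c' n / p ^ (3 m))`,
negligible when `p ^ m` is of the order of `n ^ (1 / 4)`.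

Levels `j ≥ k`, where `p ^ (2 k)` is about `n ^ (1 / 4)`, are treated crudely. The same
equidistribution shows that such a root exists with probability `O(p ^ (-2 k))`. To pass from the
probability to the expectation, note that `N` roots in one residue class modulo `p` force an `N`-th
power of a linear factor in `f` modulo `p`; this has probability at most `|A| ^ (-N)`
(`boxProb_dvd_map_le`), because the coefficients of degree at least `N` then determine the
others. Taking `N` about `n ^ ε` gives the error `O(n ^ (-1/4 + ε))`.
-/

open scoped BigOperators

section

variable {p : ℕ} [Fact p.Prime]

/-! ### Averages over finite sets of coefficient vectors -/

/-- The finite set of coefficient vectors of length `n` with entries in `A`. -/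
abbrev coeffBox (A : Finset ℤ_[p]) (n : ℕ) : Finset (Fin n → ℤ_[p]) :=
  Fintype.piFinset fun _ => A

lemma coeffBox_nonempty {A : Finset ℤ_[p]} (hA : A.Nonempty) (n : ℕ) : (coeffBox A n).Nonempty :=
  Fintype.piFinset_nonempty.mpr fun _ => hA

lemma expect_coeffBox_prod {K : Type*} [Field K] [CharZero K] (A : Finset ℤ_[p]) {n : ℕ}
    (g : Fin n → ℤ_[p] → K) :
    𝔼 a ∈ coeffBox A n, ∏ i, g i (a i) = ∏ i, 𝔼 x ∈ A, g i x := by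
  simp only [Finset.expect_eq_sum_div_card, Finset.prod_div_distrib, Finset.prod_univ_sum,
    Finset.prod_const, coeffBox, Fintype.card_piFinset]
  simp

/-- Independent coefficients, uniform on the finite set `A`, turn expectations into averages over
`coeffBox A n`; no measurability of `g` is needed, since almost surely only finitely many
coefficient vectors occur. -/
lemma integral_comp_eq_expect {n : ℕ} {Ω : Type u} [MeasurableSpace Ω] {μ : Measure Ω}
    [IsProbabilityMeasure μ] {ξ : Fin n → Ω → ℤ_[p]} (hm : ∀ i, Measurable (ξ i))
    (hind : iIndepFun ξ μ) {A : Finset ℤ_[p]} (hA : A.Nonempty)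
    (hξ : ∀ i, ∀ a ∈ A, μ {ω | ξ i ω = a} = (A.card : ℝ≥0∞)⁻¹)
    (g : (Fin n → ℤ_[p]) → ℝ) :
    Integrable (fun ω => g (fun i => ξ i ω)) μ ∧
      ∫ ω, g (fun i => ξ i ω) ∂μ = 𝔼 a ∈ coeffBox A n, g a := by
  classical
  have hq : (A.card : ℝ≥0∞) ≠ 0 := by simpa using hA.ne_empty
  have hms : ∀ (i) (a : ℤ_[p]), MeasurableSet {ω | ξ i ω = a} := fun i a =>
    hm i (measurableSet_singleton a)
  have hmem : ∀ᵐ ω ∂μ, ∀ i, ξ i ω ∈ A := by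
    rw [ae_all_iff]
    intro i
    have h1 : μ (⋃ a ∈ A, {ω | ξ i ω = a}) = 1 := by
      rw [measure_biUnion_finset]
      · rw [Finset.sum_congr rfl (hξ i), Finset.sum_const, nsmul_eq_mul,
          ENNReal.mul_inv_cancel hq (ENNReal.natCast_ne_top _)]
      · intro a _ b _ hab
        refine Set.disjoint_left.mpr fun ω h1 h2 => hab ?_
        exact Eq.trans (Eq.symm h1) h2
      · exact fun a _ => hms i a
    have h2 := (prob_compl_eq_zero_iff (Finset.measurableSet_biUnion A fun a _ => hms i a)).mpr h1
    filter_upwards [compl_mem_ae_iff.mpr h2] with ω hω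
    simpa using hω
  have hE : ∀ a : Fin n → ℤ_[p], MeasurableSet {ω | ∀ i, ξ i ω = a i} := fun a => by
    have : {ω | ∀ i, ξ i ω = a i} = ⋂ i, {ω | ξ i ω = a i} := by ext; simp
    rw [this]
    exact MeasurableSet.iInter fun i => hms i _
  have hP : ∀ a ∈ coeffBox A n, μ.real {ω | ∀ i, ξ i ω = a i} = ((A.card : ℝ) ^ n)⁻¹ := by
    intro a ha
    have h := hind.measure_inter_preimage_eq_mul Finset.univ (sets := fun i => {a i})
      (fun i _ => measurableSet_singleton _)
    have e : {ω | ∀ i, ξ i ω = a i} = ⋂ i ∈ (Finset.univ : Finset (Fin n)), ξ i ⁻¹' {a i} := by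
      ext; simp
    have h' : ∀ i ∈ Finset.univ, μ (ξ i ⁻¹' {a i}) = (A.card : ℝ≥0∞)⁻¹ := fun i _ =>
      hξ i (a i) (Fintype.mem_piFinset.mp ha i)
    rw [measureReal_def, e, h, Finset.prod_congr rfl h']
    simp
  have hae : (fun ω => g (fun i => ξ i ω)) =ᵐ[μ] fun ω => ∑ a ∈ coeffBox A n,
      Set.indicator {ω | ∀ i, ξ i ω = a i} (fun _ => g a) ω := by
    filter_upwards [hmem] with ω hω
    rw [Finset.sum_eq_single_of_mem (fun i => ξ i ω) (Fintype.mem_piFinset.mpr hω)]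
    · simp
    · intro b _ hb
      refine Set.indicator_of_notMem (fun h => hb ?_) _
      funext i
      exact (h i).symm
  have hint : ∀ a ∈ coeffBox A n,
      Integrable (Set.indicator {ω | ∀ i, ξ i ω = a i} (fun _ => g a)) μ := fun a _ =>
    (integrable_const _).indicator (hE a)
  refine ⟨(integrable_finsetSum _ hint).congr hae.symm, ?_⟩
  rw [integral_congr_ae hae, integral_finsetSum _ hint, Finset.expect_eq_sum_div_card,
    Finset.sum_div]
  refine Finset.sum_congr rfl fun a ha => ?_
  rw [integral_indicator_const _ (hE a), hP a ha, Fintype.card_piFinset]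
  simp [div_eq_inv_mul]

/-! ### Additive characters of `ℤ_p` -/

/-- The geometric sum `∑ j < N, z ^ j` vanishes, so the `N` differences `1 - z ^ j` add up to `N`;
this keeps `z` at distance at least `1 / N` from `1`. -/
lemma norm_one_sub_ge_of_pow_eq_one {z : ℂ} {N : ℕ} (hN : 0 < N) (hz : z ^ N = 1) (h1 : z ≠ 1) :
    1 / (N : ℝ) ≤ ‖1 - z‖ := by
  have hz1 : ‖z‖ = 1 := Complex.norm_eq_one_of_pow_eq_one hz hN.ne'
  have hgeom : ∑ j ∈ Finset.range N, z ^ j = 0 := by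
    rw [geom_sum_eq h1, hz, sub_self, zero_div]
  have hj : ∀ j : ℕ, ‖1 - z ^ j‖ ≤ j * ‖1 - z‖ := by
    intro j
    rw [← mul_neg_geom_sum, norm_mul, mul_comm]
    refine mul_le_mul_of_nonneg_right ((norm_sum_le _ _).trans ?_) (norm_nonneg _)
    simp [hz1]
  have hsum : (N : ℝ) ≤ ∑ j ∈ Finset.range N, ‖1 - z ^ j‖ := by
    have h : (N : ℂ) = ∑ j ∈ Finset.range N, (1 - z ^ j) := by
      rw [Finset.sum_sub_distrib, hgeom]; simp
    have h' : (N : ℝ) = ‖(N : ℂ)‖ := by simp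
    rw [h', h]
    exact norm_sum_le _ _
  have hle : ∑ j ∈ Finset.range N, ‖1 - z ^ j‖ ≤ ∑ _j ∈ Finset.range N, (N : ℝ) * ‖1 - z‖ := by
    refine Finset.sum_le_sum fun j hj' => (hj j).trans ?_
    have : (j : ℝ) ≤ N := by exact_mod_cast (Finset.mem_range.mp hj').le
    exact mul_le_mul_of_nonneg_right this (norm_nonneg _)
  rw [Finset.sum_const, Finset.card_range, nsmul_eq_mul] at hle
  have hN' : (0 : ℝ) < N := by exact_mod_cast hN
  have h3 : (N : ℝ) * 1 ≤ N * (N * ‖1 - z‖) := by linarith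
  have h4 := le_of_mul_le_mul_left h3 hN'
  rwa [div_le_iff₀ hN', mul_comm]

lemma norm_one_add_le_of_pow_eq_one {z : ℂ} {N : ℕ} (hN : 0 < N) (hz : z ^ N = 1) (h1 : z ≠ 1) :
    ‖1 + z‖ ≤ 2 - 1 / (4 * (N : ℝ) ^ 2) := by
  have hz1 : ‖z‖ = 1 := Complex.norm_eq_one_of_pow_eq_one hz hN.ne'
  have h := norm_one_sub_ge_of_pow_eq_one hN hz h1
  have hp := parallelogram_law_with_norm ℝ (1 : ℂ) z
  rw [hz1, norm_one] at hp
  have hN' : (1 : ℝ) ≤ N := by exact_mod_cast hN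
  set t : ℝ := 1 / (N : ℝ)
  have ht0 : 0 < t := by positivity
  have ht1 : t ≤ 1 := by rw [div_le_one (by positivity)]; exact hN'
  have e : 1 / (4 * (N : ℝ) ^ 2) = t ^ 2 / 4 := by simp only [t]; field_simp
  rw [e]
  have ht2 : t ^ 2 ≤ ‖1 - z‖ ^ 2 := by gcongr
  have hp0 := norm_nonneg (1 + z)
  refine (le_abs_self _).trans (abs_le_of_sq_le_sq ?_ (by nlinarith))
  nlinarith [sq_nonneg (t ^ 2)]

/-- Averaging an additive character over a finite set loses a definite amount as soon as the
character separates two of its points. -/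
lemma norm_expect_addChar_le {G : Type*} [AddCommGroup G] [DecidableEq G] {A : Finset G}
    (χ : AddChar G ℂ) {N : ℕ} (hN : 0 < N) (hχ : ∀ x, χ x ^ N = 1) {a b : G} (ha : a ∈ A)
    (hb : b ∈ A) (hab : χ (b - a) ≠ 1) :
    ‖𝔼 x ∈ A, χ x‖ ≤ 1 - 1 / (4 * (N : ℝ) ^ 2 * A.card) := by
  have hn : ∀ x, ‖χ x‖ = 1 := fun x => Complex.norm_eq_one_of_pow_eq_one (hχ x) hN.ne'
  have hne : b ≠ a := by
    rintro rfl; simp at hab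
  have hb' : b ∈ A.erase a := Finset.mem_erase.mpr ⟨hne, hb⟩
  have hq : 0 < A.card := Finset.card_pos.mpr ⟨a, ha⟩
  have hcard : ((((A.erase a).erase b).card : ℕ) : ℝ) = A.card - 2 := by
    have h2 : ((A.erase a).erase b).card + 2 = A.card := by
      rw [← Finset.card_erase_add_one ha, ← Finset.card_erase_add_one hb']
    rw [← h2]; push_cast; ring
  have hsplit : ∑ x ∈ A, χ x = (χ a + χ b) + ∑ x ∈ (A.erase a).erase b, χ x := by
    rw [← Finset.add_sum_erase A _ ha, ← Finset.add_sum_erase _ _ hb', add_assoc]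
  have h1 : ‖χ a + χ b‖ ≤ 2 - 1 / (4 * (N : ℝ) ^ 2) := by
    have : χ a + χ b = χ a * (1 + χ (b - a)) := by
      rw [mul_add, mul_one, ← AddChar.map_add_eq_mul]; simp
    rw [this, norm_mul, hn, one_mul]
    exact norm_one_add_le_of_pow_eq_one hN (hχ _) hab
  have h2 : ‖∑ x ∈ (A.erase a).erase b, χ x‖ ≤ A.card - 2 := by
    refine (norm_sum_le _ _).trans ?_
    simp only [hn, Finset.sum_const, nsmul_eq_mul, mul_one, hcard, le_refl]
  have hq' : (0 : ℝ) < A.card := by exact_mod_cast hq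
  rw [Finset.expect_eq_sum_div_card, norm_div, hsplit, Complex.norm_natCast, div_le_iff₀ hq']
  refine (norm_add_le _ _).trans ((add_le_add h1 h2).trans (le_of_eq ?_))
  have : (N : ℝ) ≠ 0 := by exact_mod_cast hN.ne'
  field_simp
  ring

lemma norm_expect_addChar_le_one {G : Type*} [AddCommGroup G] (A : Finset G)
    (χ : AddChar G ℂ) {N : ℕ} (hN : 0 < N) (hχ : ∀ x, χ x ^ N = 1) :
    ‖𝔼 x ∈ A, χ x‖ ≤ 1 := by
  have hn : ∀ x, ‖χ x‖ = 1 := fun x => Complex.norm_eq_one_of_pow_eq_one (hχ x) hN.ne'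
  rw [Finset.expect_eq_sum_div_card, norm_div, Complex.norm_natCast]
  refine div_le_one_of_le₀ ((norm_sum_le _ _).trans ?_) (by positivity)
  simp [hn]

/-- The character `x ↦ e(c x / p ^ α) e(d x / p ^ β)` of `ℤ_p`. -/
noncomputable def residueChar (α β : ℕ) (c : ZMod (p ^ α)) (d : ZMod (p ^ β)) :
    AddChar ℤ_[p] ℂ :=
  (ZMod.stdAddChar.mulShift c).compAddMonoidHom (PadicInt.toZModPow α).toAddMonoidHom *
    (ZMod.stdAddChar.mulShift d).compAddMonoidHom (PadicInt.toZModPow β).toAddMonoidHom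

lemma residueChar_apply {α β : ℕ} (c : ZMod (p ^ α)) (d : ZMod (p ^ β)) (x : ℤ_[p]) :
    residueChar α β c d x = ZMod.stdAddChar (c * PadicInt.toZModPow α x) *
      ZMod.stdAddChar (d * PadicInt.toZModPow β x) := by
  rfl

lemma residueChar_pow {α β m : ℕ} (hα : α ≤ m) (hβ : β ≤ m) (c : ZMod (p ^ α))
    (d : ZMod (p ^ β)) (x : ℤ_[p]) : residueChar α β c d x ^ p ^ m = 1 := by
  have h0 : ∀ γ ≤ m, ((p : ZMod (p ^ γ)) ^ m) = 0 := fun γ hγ => by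
    rw [← Nat.cast_pow, ZMod.natCast_eq_zero_iff]
    exact pow_dvd_pow p hγ
  rw [← AddChar.map_nsmul_eq_pow, residueChar_apply]
  simp [h0 α hα, h0 β hβ]

lemma residueChar_ne_one_left {α β : ℕ} {c : ZMod (p ^ α)} (hc : c ≠ 0) {x : ℤ_[p]}
    (hx : IsUnit x) : residueChar α β c 0 x ≠ 1 := by
  rw [residueChar_apply, zero_mul, AddChar.map_zero_eq_one, mul_one]
  intro h
  rw [← AddChar.map_zero_eq_one (ZMod.stdAddChar (N := p ^ α))] at h
  have := ZMod.injective_stdAddChar h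
  exact hc ((hx.map (PadicInt.toZModPow α)).mul_left_eq_zero.mp this)

lemma residueChar_ne_one_right {α β : ℕ} {d : ZMod (p ^ β)} (hd : d ≠ 0) {x : ℤ_[p]}
    (hx : IsUnit x) : residueChar α β 0 d x ≠ 1 := by
  rw [residueChar_apply, zero_mul, AddChar.map_zero_eq_one, one_mul]
  intro h
  rw [← AddChar.map_zero_eq_one (ZMod.stdAddChar (N := p ^ β))] at h
  have := ZMod.injective_stdAddChar h
  exact hd ((hx.map (PadicInt.toZModPow β)).mul_left_eq_zero.mp this)

lemma sum_stdAddChar_mul (N : ℕ) [NeZero N] (b : ZMod N) :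
    ∑ c : ZMod N, ZMod.stdAddChar (c * b) = if b = 0 then (N : ℂ) else 0 := by
  rw [AddChar.sum_mulShift b (ZMod.isPrimitive_stdAddChar N), ZMod.card]
  split_ifs <;> simp

/-- Orthogonality of characters detects simultaneous divisibility. -/
lemma sum_sum_stdAddChar_mul (α β : ℕ) (x y : ℤ_[p]) :
    ∑ c : ZMod (p ^ α), ∑ d : ZMod (p ^ β), ZMod.stdAddChar (c * PadicInt.toZModPow α x) *
      ZMod.stdAddChar (d * PadicInt.toZModPow β y) =
    if PadicInt.toZModPow α x = 0 ∧ PadicInt.toZModPow β y = 0 then (p : ℂ) ^ (α + β) else 0 := by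
  rw [← Fintype.sum_mul_sum, sum_stdAddChar_mul, sum_stdAddChar_mul]
  split_ifs <;> simp_all [pow_add]

/-- A product of factors in `[0, 1]`, of which those with index `e + T l` are at most `ρ`. -/
lemma prod_range_le_pow_div {F : ℕ → ℝ} {ρ : ℝ} {n T e : ℕ} (he : e < T)
    (h0 : ∀ i, 0 ≤ F i) (h1 : ∀ i, F i ≤ 1) (hρ : ∀ l, F (e + T * l) ≤ ρ) :
    ∏ i ∈ Finset.range n, F i ≤ ρ ^ (n / T) := by
  have hinj : Function.Injective fun l => e + T * l := fun a b h => by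
    have : T * a = T * b := by simpa using h
    exact Nat.eq_of_mul_eq_mul_left (by omega) this
  have hsub : (Finset.range (n / T)).image (fun l => e + T * l) ⊆ Finset.range n := by
    intro i hi
    obtain ⟨l, hl, rfl⟩ := Finset.mem_image.mp hi
    rw [Finset.mem_range] at hl ⊢
    calc e + T * l < T * (l + 1) := by rw [mul_add, mul_one]; omega
      _ ≤ T * (n / T) := Nat.mul_le_mul_left _ hl
      _ ≤ n := Nat.mul_div_le n T
  rw [← Finset.prod_sdiff hsub]
  refine (mul_le_of_le_one_left (Finset.prod_nonneg fun _ _ => h0 _)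
    (Finset.prod_le_one (fun _ _ => h0 _) fun _ _ => h1 _)).trans ?_
  rw [Finset.prod_image hinj.injOn]
  refine (Finset.prod_le_prod (fun _ _ => h0 _) fun l _ => hρ l).trans ?_
  simp

/-! ### Joint equidistribution of the values of the polynomial and its derivative -/

/-- The polynomial `monicPoly a`, with its coefficients kept in `ℤ_p`. -/
noncomputable def monicPolyInt {n : ℕ} (a : Fin n → ℤ_[p]) : ℤ_[p][X] :=
  (∑ i : Fin n, C (a i) * X ^ (i : ℕ)) + X ^ n

lemma monicPolyInt_eval {n : ℕ} (a : Fin n → ℤ_[p]) (x : ℤ_[p]) :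
    (monicPolyInt a).eval x = (∑ i : Fin n, a i * x ^ (i : ℕ)) + x ^ n := by
  simp [monicPolyInt, eval_finsetSum]

lemma monicPolyInt_derivative_eval {n : ℕ} (a : Fin n → ℤ_[p]) (x : ℤ_[p]) :
    (derivative (monicPolyInt a)).eval x =
      (∑ i : Fin n, a i * ((i : ℕ) * x ^ ((i : ℕ) - 1))) + n * x ^ (n - 1) := by
  simp [monicPolyInt, eval_finsetSum, derivative_X_pow]

/-- The proportion of the coefficient vectors in `coeffBox A n` that lie in `E`: the probability
of `E` when the coefficients are independent and uniform on `A`. -/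
noncomputable def boxProb (A : Finset ℤ_[p]) (n : ℕ) (E : Set (Fin n → ℤ_[p])) : ℝ :=
  𝔼 a ∈ coeffBox A n, E.indicator 1 a

/-- The coefficient vectors whose polynomial and its derivative are divisible at `r` by `p ^ α`
and `p ^ β` respectively. -/
def divisibleAt (n α β r : ℕ) : Set (Fin n → ℤ_[p]) :=
  {a | (p : ℤ_[p]) ^ α ∣ (monicPolyInt a).eval (r : ℤ_[p]) ∧
    (p : ℤ_[p]) ^ β ∣ (derivative (monicPolyInt a)).eval (r : ℤ_[p])}

lemma toZModPow_eq_zero_iff (α : ℕ) (x : ℤ_[p]) :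
    PadicInt.toZModPow α x = 0 ↔ (p : ℤ_[p]) ^ α ∣ x := by
  rw [← RingHom.mem_ker, PadicInt.ker_toZModPow, Ideal.mem_span_singleton]

lemma addChar_map_sum {ι G R : Type*} [AddCommMonoid G] [CommMonoid R] (ψ : AddChar G R)
    (s : Finset ι) (g : ι → G) : ψ (∑ i ∈ s, g i) = ∏ i ∈ s, ψ (g i) := by
  classical
  induction s using Finset.induction_on with
  | empty => simp
  | insert i s hi ih => rw [Finset.sum_insert hi, Finset.prod_insert hi, AddChar.map_add_eq_mul, ih]

/-- The bound for the nontrivial Fourier coefficients of the joint law of `f(r)` and `f'(r)`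
modulo powers of `p` up to `p ^ m`. -/
noncomputable def mixError (A : Finset ℤ_[p]) (m n : ℕ) : ℝ :=
  (1 - 1 / (4 * ((p ^ m : ℕ) : ℝ) ^ 2 * A.card)) ^ (n / ((p - 1) * p ^ m))

lemma mixError_nonneg {A : Finset ℤ_[p]} (hA : A.Nonempty) (m n : ℕ) : 0 ≤ mixError A m n := by
  have h1 : (1 : ℝ) ≤ A.card := by exact_mod_cast hA.card_pos
  have h2 : (1 : ℝ) ≤ (p ^ m : ℕ) := by exact_mod_cast Nat.pos_of_neZero (p ^ m)
  refine pow_nonneg (sub_nonneg.mpr ?_) _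
  rw [div_le_one (by positivity)]
  nlinarith [mul_le_mul (pow_le_pow_left₀ zero_le_one h2 2) h1 zero_le_one (by positivity)]

lemma natCast_pow_period {α m : ℕ} (hα : α ≤ m) (hm : 1 ≤ m) {r : ℕ} (hr : r.Coprime p) :
    ((r : ZMod (p ^ α)) ^ ((p - 1) * p ^ m)) = 1 := by
  have hp : p.Prime := Fact.out
  have hdvd : (p ^ α).totient ∣ (p - 1) * p ^ m := by
    refine (Nat.totient_dvd_of_dvd (pow_dvd_pow p hα)).trans ?_
    rw [Nat.totient_prime_pow hp (by omega), mul_comm]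
    exact Nat.mul_dvd_mul_left _ (pow_dvd_pow p (Nat.sub_le _ _))
  obtain ⟨k, hk⟩ := hdvd
  have h := ZMod.pow_totient (ZMod.unitOfCoprime r (hr.pow_right α))
  have h' := congrArg (Units.val) h
  simp only [Units.val_pow_eq_pow_val, ZMod.coe_unitOfCoprime, Units.val_one] at h'
  rw [hk, pow_mul, h', one_pow]

/-- The arithmetic heart of the equidistribution: for `i ≡ 0` the coefficient `a i` enters
`(f(r), f'(r))` along `(1, 0)`, for `i ≡ 1` along `(r, 1)`, the congruences being modulo
a common period of `r ^ i` and `i`. -/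
lemma norm_expect_residueChar_prod_le {A : Finset ℤ_[p]} {u v : ℤ_[p]} (hu : u ∈ A) (hv : v ∈ A)
    (huv : IsUnit (v - u)) {α β m : ℕ} (hα : α ≤ m) (hβ : β ≤ m) (hm : 1 ≤ m) {r : ℕ}
    (hr : r.Coprime p) (n : ℕ) {c : ZMod (p ^ α)} {d : ZMod (p ^ β)} (hcd : ¬ (c = 0 ∧ d = 0)) :
    ∏ i ∈ Finset.range n, ‖𝔼 x ∈ A, residueChar α β (c * (r : ZMod (p ^ α)) ^ i)
        (d * (i * (r : ZMod (p ^ β)) ^ (i - 1))) x‖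
      ≤ mixError A m n := by
  classical
  have hp : p.Prime := Fact.out
  have hN : 0 < p ^ m := Nat.pos_of_neZero _
  have hT : 1 < (p - 1) * p ^ m := by
    have h1 : p ≤ p ^ m := Nat.le_self_pow (by omega) p
    have h2 := hp.two_le
    have h3 : 1 ≤ p - 1 := by omega
    nlinarith
  have hT0 : (((p - 1) * p ^ m : ℕ) : ZMod (p ^ β)) = 0 := by
    rw [ZMod.natCast_eq_zero_iff]
    exact Dvd.dvd.mul_left (pow_dvd_pow p hβ) _
  have key : ∀ e < (p - 1) * p ^ m, (∀ l x, IsUnit x →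
      residueChar α β (c * (r : ZMod (p ^ α)) ^ (e + (p - 1) * p ^ m * l))
        (d * ((e + (p - 1) * p ^ m * l : ℕ) *
          (r : ZMod (p ^ β)) ^ (e + (p - 1) * p ^ m * l - 1))) x ≠ 1) →
      ∏ i ∈ Finset.range n, ‖𝔼 x ∈ A, residueChar α β (c * (r : ZMod (p ^ α)) ^ i)
        (d * (i * (r : ZMod (p ^ β)) ^ (i - 1))) x‖
      ≤ mixError A m n := by
    intro e he h
    refine prod_range_le_pow_div he (fun _ => norm_nonneg _)
      (fun i => norm_expect_addChar_le_one A _ hN (residueChar_pow hα hβ _ _)) fun l => ?_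
    exact norm_expect_addChar_le _ hN (residueChar_pow hα hβ _ _) hu hv (h l _ huv)
  by_cases hc : c = 0
  · subst hc
    have hd : d ≠ 0 := fun h => hcd ⟨rfl, h⟩
    refine key 1 hT fun l x hx => ?_
    have e : d * (((1 + (p - 1) * p ^ m * l : ℕ) : ZMod (p ^ β)) *
        r ^ (1 + (p - 1) * p ^ m * l - 1)) = d := by
      rw [Nat.cast_add, Nat.cast_mul, hT0, Nat.add_sub_cancel_left, pow_mul,
        natCast_pow_period hβ hm hr]
      simp
    rw [e, zero_mul]
    exact residueChar_ne_one_right hd hx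
  · refine key 0 (by omega) fun l x hx => ?_
    have e : d * (((0 + (p - 1) * p ^ m * l : ℕ) : ZMod (p ^ β)) *
        r ^ (0 + (p - 1) * p ^ m * l - 1)) = 0 := by
      rw [zero_add, Nat.cast_mul, hT0]
      simp
    rw [e, zero_add, pow_mul, natCast_pow_period hα hm hr, one_pow, mul_one]
    exact residueChar_ne_one_left hc hx

/-- Joint equidistribution of `f(r)` and `f'(r)` modulo powers of `p`. -/
lemma abs_boxProb_divisibleAt_sub_le {A : Finset ℤ_[p]} {u v : ℤ_[p]} (hu : u ∈ A) (hv : v ∈ A)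
    (huv : IsUnit (v - u)) {α β m : ℕ} (hα : α ≤ m) (hβ : β ≤ m) (hm : 1 ≤ m) {r : ℕ}
    (hr : r.Coprime p) (n : ℕ) :
    |boxProb A n (divisibleAt n α β r) - 1 / (p : ℝ) ^ (α + β)| ≤ mixError A m n := by
  classical
  have hp : p.Prime := Fact.out
  have hA : A.Nonempty := ⟨u, hu⟩
  set δ := mixError A m n with hδ
  have hδ0 : 0 ≤ δ := mixError_nonneg hA m n
  let w : ZMod (p ^ α) → ZMod (p ^ β) → ℂ := fun c d =>
    𝔼 a ∈ coeffBox A n,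
      ZMod.stdAddChar (c * PadicInt.toZModPow α ((monicPolyInt a).eval (r : ℤ_[p]))) *
      ZMod.stdAddChar (d * PadicInt.toZModPow β ((derivative (monicPolyInt a)).eval (r : ℤ_[p])))
  have hw0 : w 0 0 = 1 := by
    simp only [w, zero_mul, AddChar.map_zero_eq_one, mul_one]
    exact Finset.expect_const (coeffBox_nonempty hA n) 1
  have hw : ∀ c d, ¬ (c = 0 ∧ d = 0) → ‖w c d‖ ≤ δ := by
    intro c d hcd
    have e : w c d = residueChar α β (c * (r : ZMod (p ^ α)) ^ n)
        (d * (n * (r : ZMod (p ^ β)) ^ (n - 1))) (1 : ℤ_[p]) *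
        ∏ i : Fin n, 𝔼 x ∈ A, residueChar α β (c * (r : ZMod (p ^ α)) ^ (i : ℕ))
          (d * ((i : ℕ) * (r : ZMod (p ^ β)) ^ ((i : ℕ) - 1))) x := by
      rw [← expect_coeffBox_prod, Finset.mul_expect]
      refine Finset.expect_congr rfl fun a _ => ?_
      rw [monicPolyInt_eval, monicPolyInt_derivative_eval]
      simp only [residueChar_apply, map_add, map_sum, map_mul, map_pow, map_natCast, map_one,
        mul_add, Finset.mul_sum, AddChar.map_add_eq_mul, addChar_map_sum,
        Finset.prod_mul_distrib]
      have e1 : ∀ i : Fin n, c * (PadicInt.toZModPow α (a i) * (r : ZMod (p ^ α)) ^ (i : ℕ)) =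
        c * r ^ (i : ℕ) * PadicInt.toZModPow α (a i) := fun i => by ring
      have e2 : ∀ i : Fin n, d * (PadicInt.toZModPow β (a i) *
          (((i : ℕ) : ZMod (p ^ β)) * (r : ZMod (p ^ β)) ^ ((i : ℕ) - 1))) =
        d * ((i : ℕ) * (r : ZMod (p ^ β)) ^ ((i : ℕ) - 1)) * PadicInt.toZModPow β (a i) :=
        fun i => by ring
      simp only [e1, e2, mul_one]
      ring
    rw [e, norm_mul, Complex.norm_eq_one_of_pow_eq_one (residueChar_pow hα hβ _ _ _)
      (Nat.pos_of_neZero _).ne', one_mul, norm_prod]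
    rw [Fin.prod_univ_eq_prod_range (fun i => ‖𝔼 x ∈ A, residueChar α β (c * (r : ZMod (p ^ α)) ^ i)
      (d * ((i : ZMod (p ^ β)) * r ^ (i - 1))) x‖)]
    exact norm_expect_residueChar_prod_le hu hv huv hα hβ hm hr n hcd
  have hsum : ∑ c, ∑ d, w c d = (p : ℂ) ^ (α + β) * boxProb A n (divisibleAt n α β r) := by
    simp only [w, ← Finset.expect_sum_comm, sum_sum_stdAddChar_mul]
    rw [boxProb, Complex.ofReal_expect, Finset.mul_expect]
    refine Finset.expect_congr rfl fun a _ => ?_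
    simp only [toZModPow_eq_zero_iff]
    by_cases h : a ∈ divisibleAt n α β r
    · rw [Set.indicator_of_mem h, if_pos (by exact h)]; simp
    · rw [Set.indicator_of_notMem h, if_neg (by exact h)]; simp
  have hP : (0 : ℝ) < (p : ℝ) ^ (α + β) := pow_pos (by exact_mod_cast hp.pos) _
  have hdiff : ‖(p : ℂ) ^ (α + β) * boxProb A n (divisibleAt n α β r) - 1‖ ≤
      (p : ℝ) ^ (α + β) * δ := by
    rw [← hsum, ← Fintype.sum_prod_type', ← Finset.add_sum_erase _ _ (Finset.mem_univ (0, 0)), hw0,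
      add_sub_cancel_left]
    refine (norm_sum_le _ _).trans ((Finset.sum_le_card_nsmul _ _ δ ?_).trans ?_)
    · rintro ⟨c, d⟩ hcd
      refine hw c d fun h => (Finset.mem_erase.mp hcd).1 ?_
      rw [h.1, h.2]
    · rw [nsmul_eq_mul]
      refine mul_le_mul_of_nonneg_right ?_ hδ0
      calc ((((Finset.univ.erase ((0 : ZMod (p ^ α)), (0 : ZMod (p ^ β)))).card : ℕ)) : ℝ)
          ≤ ((Finset.univ : Finset (ZMod (p ^ α) × ZMod (p ^ β))).card : ℝ) := by
            exact_mod_cast Finset.card_erase_le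
        _ = (p : ℝ) ^ (α + β) := by
            rw [Finset.card_univ, Fintype.card_prod, ZMod.card, ZMod.card, pow_add]; push_cast; rfl
  have hreal : (p : ℂ) ^ (α + β) * boxProb A n (divisibleAt n α β r) - 1 =
      (((p : ℝ) ^ (α + β) * (boxProb A n (divisibleAt n α β r) - 1 / (p : ℝ) ^ (α + β)) : ℝ) : ℂ)
      := by
    rw [mul_sub, mul_one_div_cancel hP.ne']; push_cast; rfl
  rw [hreal, Complex.norm_real, Real.norm_eq_abs, abs_mul, abs_of_pos hP] at hdiff
  exact le_of_mul_le_mul_left hdiff hP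

/-! ### Counting roots by Hensel's lemma -/

lemma padicInt_isUnit_iff_not_dvd (x : ℤ_[p]) : IsUnit x ↔ ¬ (p : ℤ_[p]) ∣ x := by
  rw [← PadicInt.norm_lt_one_iff_dvd, PadicInt.isUnit_iff, not_lt]
  exact ⟨fun h => h.ge, fun h => le_antisymm (PadicInt.norm_le_one x) h⟩

lemma natCast_coprime_iff_isUnit (r : ℕ) : r.Coprime p ↔ IsUnit (r : ℤ_[p]) := by
  have hp : p.Prime := Fact.out
  rw [padicInt_isUnit_iff_not_dvd, Nat.coprime_comm, hp.coprime_iff_not_dvd]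
  have := PadicInt.norm_int_lt_one_iff_dvd (p := p) (r : ℤ)
  rw [← PadicInt.norm_lt_one_iff_dvd]
  simp only [Int.cast_natCast] at this
  rw [this, Int.natCast_dvd_natCast]

lemma dvd_sub_appr (x : ℤ_[p]) (k : ℕ) : (p : ℤ_[p]) ^ k ∣ x - (x.appr k : ℤ_[p]) :=
  Ideal.mem_span_singleton.mp (PadicInt.appr_spec k x)

lemma isUnit_iff_of_dvd_sub {x y : ℤ_[p]} (h : (p : ℤ_[p]) ∣ x - y) : IsUnit x ↔ IsUnit y := by
  rw [padicInt_isUnit_iff_not_dvd, padicInt_isUnit_iff_not_dvd, not_iff_not]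
  exact ⟨fun hx => by simpa using dvd_sub hx h, fun hy => by simpa using dvd_add h hy⟩

lemma pow_dvd_derivative_iff (f : ℤ_[p][X]) {x y : ℤ_[p]} {i k : ℕ} (hik : i ≤ k)
    (h : (p : ℤ_[p]) ^ k ∣ x - y) :
    (p : ℤ_[p]) ^ i ∣ (derivative f).eval x ↔ (p : ℤ_[p]) ^ i ∣ (derivative f).eval y := by
  have hd := ((pow_dvd_pow (p : ℤ_[p]) hik).trans h).trans (sub_dvd_eval_sub x y (derivative f))
  exact ⟨fun hx => by simpa using dvd_sub hx hd, fun hy => by simpa using dvd_add hd hy⟩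

/-- Near a root with derivative divisible by `p ^ i`, at distance `p ^ k` with `i ≤ k`, the
polynomial is divisible by `p ^ (i + k)`. -/
lemma pow_dvd_eval_of_root (f : ℤ_[p][X]) {x y : ℤ_[p]} {i k : ℕ} (hik : i ≤ k)
    (hx : f.eval x = 0) (hd : (p : ℤ_[p]) ^ i ∣ (derivative f).eval x)
    (h : (p : ℤ_[p]) ^ k ∣ x - y) : (p : ℤ_[p]) ^ (i + k) ∣ f.eval y := by
  obtain ⟨q, hq⟩ := f.binomExpansion x (y - x)
  have h' : (p : ℤ_[p]) ^ k ∣ y - x := by rw [← neg_sub]; exact (dvd_neg.mpr h)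
  rw [add_sub_cancel, hx, zero_add] at hq
  rw [hq]
  refine dvd_add ?_ (Dvd.dvd.mul_left ?_ _)
  · rw [pow_add]; exact mul_dvd_mul hd h'
  · rw [pow_add, sq]; exact mul_dvd_mul ((pow_dvd_pow _ hik).trans h') h'

/-- The unit roots of `f` at which the derivative has valuation exactly `j`. -/
noncomputable def unitRootsOfLevel (f : ℤ_[p][X]) (j : ℕ) : Finset ℤ_[p] := by
  classical
  exact f.roots.toFinset.filter fun x => IsUnit x ∧
    (p : ℤ_[p]) ^ j ∣ (derivative f).eval x ∧ ¬ (p : ℤ_[p]) ^ (j + 1) ∣ (derivative f).eval x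

/-- The unit roots of `f` at which the derivative is divisible by `p ^ k`. -/
noncomputable def unitRootsAbove (f : ℤ_[p][X]) (k : ℕ) : Finset ℤ_[p] := by
  classical
  exact f.roots.toFinset.filter fun x => IsUnit x ∧ (p : ℤ_[p]) ^ k ∣ (derivative f).eval x

lemma mem_unitRootsOfLevel {f : ℤ_[p][X]} (hf : f ≠ 0) {j : ℕ} {x : ℤ_[p]} :
    x ∈ unitRootsOfLevel f j ↔ f.eval x = 0 ∧ IsUnit x ∧
      (p : ℤ_[p]) ^ j ∣ (derivative f).eval x ∧ ¬ (p : ℤ_[p]) ^ (j + 1) ∣ (derivative f).eval x := by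
  simp [unitRootsOfLevel, hf]

lemma mem_unitRootsAbove {f : ℤ_[p][X]} (hf : f ≠ 0) {k : ℕ} {x : ℤ_[p]} :
    x ∈ unitRootsAbove f k ↔ f.eval x = 0 ∧ IsUnit x ∧ (p : ℤ_[p]) ^ k ∣ (derivative f).eval x := by
  simp [unitRootsAbove, hf]

lemma card_unitRootsAbove_zero {f : ℤ_[p][X]} (hf : f ≠ 0) (k : ℕ) :
    (unitRootsAbove f 0).card =
      ∑ j ∈ Finset.range k, (unitRootsOfLevel f j).card + (unitRootsAbove f k).card := by
  classical
  induction k with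
  | zero => simp
  | succ k ih =>
    rw [ih, Finset.sum_range_succ, add_assoc, add_right_inj]
    rw [← Finset.card_filter_add_card_filter_not (s := unitRootsAbove f k)
      (fun x => (p : ℤ_[p]) ^ (k + 1) ∣ (derivative f).eval x), add_comm]
    congr 2
    · ext x
      rw [Finset.mem_filter, mem_unitRootsAbove hf, mem_unitRootsOfLevel hf]
      tauto
    · ext x
      rw [Finset.mem_filter, mem_unitRootsAbove hf, mem_unitRootsAbove hf]
      exact ⟨fun h => ⟨h.1.1, h.1.2.1, h.2⟩,
        fun h => ⟨⟨h.1, h.2.1, (pow_dvd_pow _ (Nat.le_succ k)).trans h.2.2⟩, h.2.2⟩⟩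

/-- The exact form of Hensel's lemma: a residue `r` modulo `p ^ (j + 1)` at which the derivative
has valuation `j` contains a root precisely when `p ^ (2 j + 1)` divides `f(r)`, and the root
is then unique. -/
lemma card_unitRootsOfLevel {f : ℤ_[p][X]} (hf : f ≠ 0) (j : ℕ)
    [DecidablePred fun r : ℕ => r.Coprime p ∧ (p : ℤ_[p]) ^ (2 * j + 1) ∣ f.eval (r : ℤ_[p]) ∧
      (p : ℤ_[p]) ^ j ∣ (derivative f).eval (r : ℤ_[p]) ∧
      ¬ (p : ℤ_[p]) ^ (j + 1) ∣ (derivative f).eval (r : ℤ_[p])] :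
    (unitRootsOfLevel f j).card = ((Finset.range (p ^ (j + 1))).filter fun r : ℕ =>
      r.Coprime p ∧ (p : ℤ_[p]) ^ (2 * j + 1) ∣ f.eval (r : ℤ_[p]) ∧
      (p : ℤ_[p]) ^ j ∣ (derivative f).eval (r : ℤ_[p]) ∧
      ¬ (p : ℤ_[p]) ^ (j + 1) ∣ (derivative f).eval (r : ℤ_[p])).card := by
  have hp : p.Prime := Fact.out
  refine Finset.card_bij (fun x _ => x.appr (j + 1)) ?_ ?_ ?_
  · intro x hx
    rw [mem_unitRootsOfLevel hf] at hx
    obtain ⟨h0, hu, h1, h2⟩ := hx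
    have hd := dvd_sub_appr x (j + 1)
    rw [Finset.mem_filter, Finset.mem_range, natCast_coprime_iff_isUnit]
    refine ⟨PadicInt.appr_lt x _, (isUnit_iff_of_dvd_sub ((dvd_pow_self _ (by omega)).trans hd)).mp hu,
      ?_, (pow_dvd_derivative_iff f (by omega) hd).mp h1,
      fun h => h2 ((pow_dvd_derivative_iff f le_rfl hd).mpr h)⟩
    have := pow_dvd_eval_of_root f (Nat.le_succ j) h0 h1 hd
    rwa [show 2 * j + 1 = j + (j + 1) by ring]
  · intro x hx y hy hxy
    rw [mem_unitRootsOfLevel hf] at hx hy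
    have hd : (p : ℤ_[p]) ^ (j + 1) ∣ y - x := by
      have := dvd_sub (dvd_sub_appr y (j + 1)) (dvd_sub_appr x (j + 1))
      rw [hxy] at this
      simpa using this
    obtain ⟨q, hq⟩ := f.binomExpansion x (y - x)
    rw [add_sub_cancel, hx.1, hy.1, zero_add] at hq
    have hq' : ((derivative f).eval x + q * (y - x)) * (y - x) = 0 := by rw [hq]; ring
    rcases mul_eq_zero.mp hq' with h | h
    · refine absurd ?_ hx.2.2.2
      rw [eq_neg_of_add_eq_zero_left h]
      exact dvd_neg.mpr (hd.mul_left q)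
    · exact (sub_eq_zero.mp h).symm
  · intro r hr
    rw [Finset.mem_filter, Finset.mem_range] at hr
    obtain ⟨hrlt, hcop, h0, h1, h2⟩ := hr
    have hp0 : (0 : ℝ) < p := by exact_mod_cast hp.pos
    have hp1 : (1 : ℝ) < p := by exact_mod_cast hp.one_lt
    have hn0 : ‖f.eval (r : ℤ_[p])‖ ≤ (p : ℝ) ^ (-((2 * j + 1 : ℕ) : ℤ)) :=
      (PadicInt.norm_le_pow_iff_mem_span_pow _ _).mpr (Ideal.mem_span_singleton.mpr h0)
    have hn1 : ‖(derivative f).eval (r : ℤ_[p])‖ ≤ (p : ℝ) ^ (-((j : ℕ) : ℤ)) :=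
      (PadicInt.norm_le_pow_iff_mem_span_pow _ _).mpr (Ideal.mem_span_singleton.mpr h1)
    have hn2 : (p : ℝ) ^ (-((j : ℕ) : ℤ)) ≤ ‖(derivative f).eval (r : ℤ_[p])‖ := by
      by_contra h
      apply h2
      rw [← Ideal.mem_span_singleton, ← PadicInt.norm_le_pow_iff_mem_span_pow,
        PadicInt.norm_le_pow_iff_norm_lt_pow_add_one]
      push Not at h
      rwa [show -((j + 1 : ℕ) : ℤ) + 1 = -((j : ℕ) : ℤ) by push_cast; ring]
    have hn := le_antisymm hn1 hn2
    have hlt : ‖f.eval (r : ℤ_[p])‖ < ‖(derivative f).eval (r : ℤ_[p])‖ ^ 2 := by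
      refine hn0.trans_lt ?_
      rw [hn, ← zpow_natCast, ← zpow_mul]
      refine zpow_lt_zpow_right₀ hp1 ?_
      push_cast; linarith
    obtain ⟨z, hz0, hz1, -, -⟩ := hensels_lemma (F := f) (a := (r : ℤ_[p]))
      (by simpa only [coe_aeval_eq_eval] using hlt)
    simp only [coe_aeval_eq_eval] at hz0 hz1
    rw [hn] at hz1
    have hd : (p : ℤ_[p]) ^ (j + 1) ∣ z - (r : ℤ_[p]) := by
      rw [← Ideal.mem_span_singleton, ← PadicInt.norm_le_pow_iff_mem_span_pow,
        PadicInt.norm_le_pow_iff_norm_lt_pow_add_one]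
      rwa [show -((j + 1 : ℕ) : ℤ) + 1 = -((j : ℕ) : ℤ) by push_cast; ring]
    refine ⟨z, (mem_unitRootsOfLevel hf).mpr ⟨hz0, ?_, ?_, ?_⟩, ?_⟩
    · exact (isUnit_iff_of_dvd_sub ((dvd_pow_self _ (by omega)).trans hd)).mpr
        ((natCast_coprime_iff_isUnit r).mp hcop)
    · exact (pow_dvd_derivative_iff f (by omega) hd).mpr h1
    · exact fun h => h2 ((pow_dvd_derivative_iff f le_rfl hd).mp h)
    · have := PadicInt.zmod_congr_of_sub_mem_span (j + 1) z _ _ (PadicInt.appr_spec (j + 1) z)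
        (Ideal.mem_span_singleton.mpr hd)
      rw [ZMod.natCast_eq_natCast_iff] at this
      exact Nat.ModEq.eq_of_lt_of_lt this (PadicInt.appr_lt z _) hrlt

lemma exists_residue_of_unitRootsAbove_nonempty {f : ℤ_[p][X]} (hf : f ≠ 0) {k : ℕ} (hk : 1 ≤ k)
    (h : (unitRootsAbove f k).Nonempty) : ∃ r < p ^ k, r.Coprime p ∧
      (p : ℤ_[p]) ^ (2 * k) ∣ f.eval (r : ℤ_[p]) ∧
      (p : ℤ_[p]) ^ k ∣ (derivative f).eval (r : ℤ_[p]) := by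
  obtain ⟨x, hx⟩ := h
  obtain ⟨h0, hu, h1⟩ := (mem_unitRootsAbove hf).mp hx
  have hd := dvd_sub_appr x k
  refine ⟨x.appr k, PadicInt.appr_lt x k, ?_, ?_, (pow_dvd_derivative_iff f le_rfl hd).mp h1⟩
  · rw [natCast_coprime_iff_isUnit]
    exact (isUnit_iff_of_dvd_sub ((dvd_pow_self _ (by omega)).trans hd)).mp hu
  · rw [two_mul]
    exact pow_dvd_eval_of_root f le_rfl h0 h1 hd

/-- Distinct roots in one residue class modulo `p` merge into a multiple root modulo `p`. -/
lemma X_sub_C_pow_card_dvd_map {f : ℤ_[p][X]} (hf : f ≠ 0) {R : Finset ℤ_[p]}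
    (hR : ∀ x ∈ R, f.eval x = 0) {c : ZMod p} (hc : ∀ x ∈ R, PadicInt.toZMod x = c) :
    (X - C c) ^ R.card ∣ f.map PadicInt.toZMod := by
  have h1 : (R.val.map fun x => X - C x).prod ∣ f := by
    rw [Multiset.prod_X_sub_C_dvd_iff_le_roots hf, Multiset.le_iff_subset R.nodup]
    exact fun x hx => (mem_roots hf).mpr (hR x hx)
  have h2 := Polynomial.map_dvd PadicInt.toZMod h1
  have h3 : ((R.val.map fun x => X - C x).prod).map PadicInt.toZMod = (X - C c) ^ R.card := by
    change (∏ x ∈ R, (X - C x)).map PadicInt.toZMod = _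
    rw [Polynomial.map_prod, Finset.prod_congr rfl (g := fun _ => X - C c), Finset.prod_const]
    intro x hx
    simp [hc x hx]
  rwa [h3] at h2

lemma isUnit_of_root_of_coeff {f : ℤ_[p][X]} (hf : f ≠ 0)
    (hc : ∀ i, f.coeff i = 0 ∨ IsUnit (f.coeff i)) {x : ℤ_[p]} (hx : f.eval x = 0) (h0 : x ≠ 0) :
    IsUnit x := by
  obtain ⟨g, hg⟩ := (X_pow_dvd_iff (n := f.natTrailingDegree) (f := f)).mpr
    fun d hd => coeff_eq_zero_of_lt_natTrailingDegree hd
  have hg0 : IsUnit (g.coeff 0) := by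
    have h := congrArg (fun q => q.coeff f.natTrailingDegree) hg
    rw [coeff_X_pow_mul', if_pos le_rfl, Nat.sub_self] at h
    rw [← h]
    refine (hc _).resolve_left fun h' => hf ?_
    exact trailingCoeff_eq_zero.mp h'
  have hgx : g.eval x = 0 := by
    rw [hg, eval_mul, eval_pow, eval_X] at hx
    exact (mul_eq_zero.mp hx).resolve_left (pow_ne_zero _ h0)
  have := sub_dvd_eval_sub x 0 g
  rw [sub_zero, hgx, zero_sub, dvd_neg, ← coeff_zero_eq_eval_zero] at this
  exact isUnit_of_dvd_unit this hg0

section monicPolyInt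
variable {n : ℕ} (a : Fin n → ℤ_[p])

lemma monicPolyInt_coeff (j : ℕ) :
    (monicPolyInt a).coeff j = if h : j < n then a ⟨j, h⟩ else if j = n then 1 else 0 := by
  simp only [monicPolyInt, coeff_add, finsetSum_coeff, coeff_C_mul, coeff_X_pow]
  by_cases h1 : j < n
  · rw [dif_pos h1, if_neg (by omega), add_zero, Finset.sum_eq_single ⟨j, h1⟩]
    · simp
    · intro i _ hi
      rw [if_neg fun h => hi (Fin.ext h.symm), mul_zero]
    · simp
  · rw [dif_neg h1, Finset.sum_eq_zero, zero_add]
    intro i _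
    rw [if_neg (by omega), mul_zero]

lemma monicPolyInt_natDegree_le : (monicPolyInt a).natDegree ≤ n := by
  rw [natDegree_le_iff_coeff_eq_zero]
  intro N hN
  rw [monicPolyInt_coeff, dif_neg (by omega), if_neg (by omega)]

lemma monicPolyInt_monic : (monicPolyInt a).Monic :=
  monic_of_natDegree_le_of_coeff_eq_one n (monicPolyInt_natDegree_le a) (by
    rw [monicPolyInt_coeff, dif_neg (by omega), if_pos rfl])

lemma monicPolyInt_natDegree : (monicPolyInt a).natDegree = n := by
  refine le_antisymm (monicPolyInt_natDegree_le a) (le_natDegree_of_ne_zero ?_)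
  rw [monicPolyInt_coeff, dif_neg (by omega), if_pos rfl]
  exact one_ne_zero

lemma monicPoly_eq_map : monicPoly a = (monicPolyInt a).map (algebraMap ℤ_[p] ℚ_[p]) := by
  simp [monicPoly, monicPolyInt, Polynomial.map_sum]

/-- A monic polynomial over `ℤ_p` has all its roots in `ℚ_p` already in `ℤ_p`. -/
lemma rootCount_monicPoly [DecidableEq ℤ_[p]] :
    rootCount (monicPoly a) = (monicPolyInt a).roots.toFinset.card := by
  have hf := monicPolyInt_monic a
  rw [rootCount, ← Set.ncard_coe_finset,
    ← Set.ncard_image_of_injective _ (IsFractionRing.injective ℤ_[p] ℚ_[p])]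
  congr 1
  ext x
  simp only [Set.mem_ofPred_eq, Set.mem_image, Finset.mem_coe, Multiset.mem_toFinset,
    mem_roots hf.ne_zero, IsRoot.def, monicPoly_eq_map, eval_map_algebraMap]
  constructor
  · intro h
    have hint : IsIntegral ℤ_[p] x := ⟨_, hf, h⟩
    obtain ⟨y, rfl⟩ := IsIntegrallyClosed.isIntegral_iff.mp hint
    refine ⟨y, ?_, rfl⟩
    rw [aeval_algebraMap_apply] at h
    exact IsFractionRing.injective ℤ_[p] ℚ_[p] (by simpa using h)
  · rintro ⟨y, hy, rfl⟩
    rw [aeval_algebraMap_apply]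
    simp [hy]

/-- If all coefficients are `0` or units, every nonzero root is a unit. -/
lemma rootCount_monicPoly_eq_add (hn : 1 ≤ n) (ha : ∀ i, a i = 0 ∨ IsUnit (a i))
    [Decidable (a ⟨0, hn⟩ = 0)] :
    rootCount (monicPoly a) =
      (if a ⟨0, hn⟩ = 0 then 1 else 0) + (unitRootsAbove (monicPolyInt a) 0).card := by
  classical
  have hf := (monicPolyInt_monic a).ne_zero
  have hc : ∀ i, (monicPolyInt a).coeff i = 0 ∨ IsUnit ((monicPolyInt a).coeff i) := by
    intro i
    rw [monicPolyInt_coeff]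
    split_ifs with h1 h2
    exacts [ha _, Or.inr isUnit_one, Or.inl rfl]
  have h0 : (monicPolyInt a).eval 0 = a ⟨0, hn⟩ := by
    rw [← coeff_zero_eq_eval_zero, monicPolyInt_coeff, dif_pos]
  rw [rootCount_monicPoly, ← Finset.card_filter_add_card_filter_not
    (s := (monicPolyInt a).roots.toFinset) (fun x => x = 0)]
  congr 1
  · split_ifs with h
    · rw [Finset.card_eq_one]
      refine ⟨0, ?_⟩
      ext x
      simp only [Finset.mem_filter, Multiset.mem_toFinset, mem_roots hf, IsRoot.def,
        Finset.mem_singleton]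
      exact ⟨fun h => h.2, fun hx => ⟨by rw [hx, h0, h], hx⟩⟩
    · rw [Finset.card_eq_zero, Finset.filter_eq_empty_iff]
      rintro x hx rfl
      rw [Multiset.mem_toFinset, mem_roots hf, IsRoot.def, h0] at hx
      exact h hx
  · congr 1
    ext x
    simp only [Finset.mem_filter, Multiset.mem_toFinset, mem_roots hf, IsRoot.def,
      mem_unitRootsAbove hf, pow_zero, one_dvd, and_true]
    refine and_congr_right fun hx => ⟨fun h => isUnit_of_root_of_coeff hf hc hx h, ?_⟩
    rintro h rfl
    exact not_isUnit_zero h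

end monicPolyInt

/-! ### The expected number of roots, with free parameters -/

lemma expect_coeffBox_apply {A : Finset ℤ_[p]} (hA : A.Nonempty) {n : ℕ} (i : Fin n)
    (g : ℤ_[p] → ℝ) : 𝔼 a ∈ coeffBox A n, g (a i) = 𝔼 x ∈ A, g x := by
  classical
  have h := expect_coeffBox_prod A (n := n) (fun j x => if j = i then g x else 1)
  rw [Finset.prod_eq_single_of_mem i (Finset.mem_univ i)
    (fun j _ hj => by simp [hj, Finset.expect_const hA])] at h
  simpa using h

/-- A polynomial of degree `N` over `ZMod p` divides the reduction of a random monic polynomial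
with probability at most `|A| ^ (-N)`: the coefficients of degree at least `N` determine the others
modulo `p`, and `A` is injected into the residue field. -/
lemma boxProb_dvd_map_le {A : Finset ℤ_[p]} (hA : A.Nonempty)
    (hinj : Set.InjOn PadicInt.toZMod (A : Set ℤ_[p])) (g : (ZMod p)[X]) (n : ℕ) :
    boxProb A n {a | g ∣ (monicPolyInt a).map PadicInt.toZMod} ≤
      ((A.card : ℝ) ^ g.natDegree)⁻¹ := by
  classical
  set N := g.natDegree with hN
  have hq : (0 : ℝ) < A.card := by exact_mod_cast hA.card_pos
  set S := (coeffBox A n).filter fun a => g ∣ (monicPolyInt a).map PadicInt.toZMod with hS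
  have hP : boxProb A n {a | g ∣ (monicPolyInt a).map PadicInt.toZMod} =
      S.card / (A.card : ℝ) ^ n := by
    rw [boxProb, Finset.expect_eq_sum_div_card, Fintype.card_piFinset]
    simp [Set.indicator_apply, hS]
  rw [hP]
  rcases le_or_gt N n with hle | hlt
  · have hcard : S.card ≤ A.card ^ (n - N) := by
      have : (coeffBox A (n - N)).card = A.card ^ (n - N) := by
        rw [Fintype.card_piFinset]; simp
      rw [← this]
      refine Finset.card_le_card_of_injOn
        (fun a i => a ⟨N + i, by have := i.2; omega⟩) ?_ ?_
      · intro a ha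
        have ha' := (Finset.mem_filter.mp ha).1
        exact Fintype.mem_piFinset.mpr fun i => Fintype.mem_piFinset.mp ha' _
      · intro a ha b hb hab
        obtain ⟨ha1, ha2⟩ := Finset.mem_filter.mp ha
        obtain ⟨hb1, hb2⟩ := Finset.mem_filter.mp hb
        have hhigh : ∀ j : Fin n, N ≤ j → a j = b j := by
          intro j hj
          have := congrFun hab ⟨j - N, by have := j.2; omega⟩
          simpa [Nat.add_sub_cancel' hj] using this
        have hzero : (monicPolyInt a).map PadicInt.toZMod -
            (monicPolyInt b).map (PadicInt.toZMod (p := p)) = 0 := by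
          by_contra hne
          have hdeg := natDegree_le_of_dvd (dvd_sub ha2 hb2) hne
          have hc : ((monicPolyInt a).map PadicInt.toZMod -
              (monicPolyInt b).map (PadicInt.toZMod (p := p))).leadingCoeff = 0 := by
            rw [leadingCoeff, coeff_sub, coeff_map, coeff_map, ← map_sub, monicPolyInt_coeff,
              monicPolyInt_coeff]
            split_ifs with h1
            · rw [hhigh _ (by exact hdeg), sub_self, map_zero]
            · rw [sub_self, map_zero]
            · rw [sub_self, map_zero]
          exact hne (leadingCoeff_eq_zero.mp hc)
        funext j
        refine hinj (Fintype.mem_piFinset.mp ha1 j) (Fintype.mem_piFinset.mp hb1 j) ?_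
        have h := congrArg (fun q => q.coeff (j : ℕ)) hzero
        simpa [monicPolyInt_coeff, sub_eq_zero] using h
    rw [div_le_iff₀ (by positivity)]
    have : ((A.card : ℝ) ^ N)⁻¹ * (A.card : ℝ) ^ n = (A.card : ℝ) ^ (n - N) := by
      rw [pow_sub₀ _ hq.ne' hle, mul_comm]
    rw [this]
    exact_mod_cast hcard
  · have hempty : S = ∅ := by
      rw [hS, Finset.filter_eq_empty_iff]
      intro a _ hdvd
      have hm := (monicPolyInt_monic a).map (PadicInt.toZMod (p := p))
      have := natDegree_le_of_dvd hdvd hm.ne_zero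
      rw [(monicPolyInt_monic a).natDegree_map, monicPolyInt_natDegree] at this
      omega
    rw [hempty]
    simp only [Finset.card_empty, Nat.cast_zero, zero_div]
    positivity

/-- The residues modulo `p ^ k` prime to `p`. -/
def unitResidues (p k : ℕ) : Finset ℕ := (Finset.range (p ^ k)).filter fun r => r.Coprime p

lemma card_unitResidues_succ (j : ℕ) : (unitResidues p (j + 1)).card = p ^ j * (p - 1) := by
  have hp : p.Prime := Fact.out
  rw [← Nat.totient_prime_pow_succ hp, Nat.totient_eq_card_coprime, unitResidues]
  congr 1
  ext r
  rw [Finset.mem_filter, Finset.mem_filter, Nat.coprime_pow_left_iff (Nat.succ_pos j),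
    Nat.coprime_comm]

lemma card_unitResidues_le (q k : ℕ) : (unitResidues q k).card ≤ q ^ k :=
  (Finset.card_filter_le _ _).trans (by simp)

lemma card_unitRootsOfLevel_eq_sum {n : ℕ} (a : Fin n → ℤ_[p]) (j : ℕ) :
    ((unitRootsOfLevel (monicPolyInt a) j).card : ℝ) = ∑ r ∈ unitResidues p (j + 1),
      ((divisibleAt n (2 * j + 1) j r).indicator 1 a -
        (divisibleAt n (2 * j + 1) (j + 1) r).indicator 1 a) := by
  classical
  rw [card_unitRootsOfLevel (monicPolyInt_monic a).ne_zero, ← Finset.filter_filter,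
    Finset.card_filter, unitResidues, Nat.cast_sum]
  refine Finset.sum_congr rfl fun r _ => ?_
  have himp : (p : ℤ_[p]) ^ (j + 1) ∣ (derivative (monicPolyInt a)).eval (r : ℤ_[p]) →
      (p : ℤ_[p]) ^ j ∣ (derivative (monicPolyInt a)).eval (r : ℤ_[p]) :=
    (pow_dvd_pow _ (Nat.le_succ j)).trans
  simp only [Set.indicator_apply, divisibleAt, Set.mem_ofPred_eq, Pi.one_apply]
  by_cases h1 : (p : ℤ_[p]) ^ (2 * j + 1) ∣ (monicPolyInt a).eval (r : ℤ_[p]) <;>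
  by_cases h2 : (p : ℤ_[p]) ^ j ∣ (derivative (monicPolyInt a)).eval (r : ℤ_[p]) <;>
  by_cases h3 : (p : ℤ_[p]) ^ (j + 1) ∣ (derivative (monicPolyInt a)).eval (r : ℤ_[p]) <;>
  simp_all

/-- Roots with a derivative divisible by `p ^ k` are rare; when there are any, they number at
most `p N` unless the polynomial is divisible by an `N`-th power of a linear factor modulo `p`. -/
lemma card_unitRootsAbove_le {n : ℕ} (a : Fin n → ℤ_[p]) {k : ℕ} (hk : 1 ≤ k) (N : ℕ) :
    ((unitRootsAbove (monicPolyInt a) k).card : ℝ) ≤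
      p * N * ∑ r ∈ unitResidues p k, (divisibleAt n (2 * k) k r).indicator 1 a +
      n * ∑ c : ZMod p, Set.indicator
        {b : Fin n → ℤ_[p] | (X - C c) ^ N ∣ (monicPolyInt b).map PadicInt.toZMod} 1 a := by
  classical
  have hf := (monicPolyInt_monic a).ne_zero
  set f := monicPolyInt a with hfdef
  have hs1 : ∀ r ∈ unitResidues p k, (0 : ℝ) ≤ (divisibleAt n (2 * k) k r).indicator 1 a :=
    fun r _ => Set.indicator_nonneg (fun _ _ => zero_le_one) _
  have hs2 : ∀ c ∈ (Finset.univ : Finset (ZMod p)), (0 : ℝ) ≤ Set.indicator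
      {b : Fin n → ℤ_[p] | (X - C c) ^ N ∣ (monicPolyInt b).map PadicInt.toZMod} 1 a :=
    fun c _ => Set.indicator_nonneg (fun _ _ => zero_le_one) _
  rcases (unitRootsAbove f k).eq_empty_or_nonempty with h | h
  · rw [h, Finset.card_empty, Nat.cast_zero]
    have := Finset.sum_nonneg hs1
    have := Finset.sum_nonneg hs2
    positivity
  by_cases hc : ∃ c : ZMod p, (X - C c) ^ N ∣ f.map PadicInt.toZMod
  · obtain ⟨c, hc⟩ := hc
    have h1 := Finset.single_le_sum hs2 (Finset.mem_univ c)
    rw [Set.indicator_of_mem (by exact hc), Pi.one_apply] at h1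
    have h2 : (unitRootsAbove f k).card ≤ n := by
      calc (unitRootsAbove f k).card ≤ f.roots.toFinset.card := Finset.card_filter_le _ _
        _ ≤ Multiset.card f.roots := Multiset.toFinset_card_le _
        _ ≤ f.natDegree := card_roots' f
        _ = n := monicPolyInt_natDegree a
    have h3 : ((unitRootsAbove f k).card : ℝ) ≤ n := by exact_mod_cast h2
    have h4 := mul_le_mul_of_nonneg_left h1 (Nat.cast_nonneg (α := ℝ) n)
    have h5 := mul_nonneg (by positivity : (0 : ℝ) ≤ p * N) (Finset.sum_nonneg hs1)
    linarith
  · push Not at hc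
    obtain ⟨r, hr1, hr2, hr3⟩ := exists_residue_of_unitRootsAbove_nonempty hf hk h
    have hr : r ∈ unitResidues p k := Finset.mem_filter.mpr ⟨Finset.mem_range.mpr hr1, hr2⟩
    have h1 := Finset.single_le_sum hs1 hr
    rw [Set.indicator_of_mem (by exact hr3), Pi.one_apply] at h1
    have h2 : (unitRootsAbove f k).card ≤ N * (Finset.univ : Finset (ZMod p)).card := by
      refine Finset.card_le_mul_card_image_of_maps_to (f := PadicInt.toZMod)
        (fun _ _ => Finset.mem_univ _) N fun c _ => ?_
      by_contra hlt
      push Not at hlt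
      refine hc c ((pow_dvd_pow _ hlt.le).trans (X_sub_C_pow_card_dvd_map hf ?_ ?_))
      · exact fun x hx => ((mem_unitRootsAbove hf).mp (Finset.mem_filter.mp hx).1).1
      · exact fun x hx => (Finset.mem_filter.mp hx).2
    rw [Finset.card_univ, ZMod.card] at h2
    have h3 : ((unitRootsAbove f k).card : ℝ) ≤ p * N := by
      rw [mul_comm (p : ℝ)]; exact_mod_cast h2
    have h4 := mul_le_mul_of_nonneg_left h1 (by positivity : (0 : ℝ) ≤ p * N)
    have h5 := mul_nonneg (Nat.cast_nonneg (α := ℝ) n) (Finset.sum_nonneg hs2)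
    linarith

section Expectation
variable {A : Finset ℤ_[p]} {u v : ℤ_[p]}

lemma abs_expect_card_unitRootsOfLevel_sub_le (hu : u ∈ A) (hv : v ∈ A) (huv : IsUnit (v - u))
    {j k : ℕ} (hjk : j < k) (n : ℕ) :
    |(𝔼 a ∈ coeffBox A n, ((unitRootsOfLevel (monicPolyInt a) j).card : ℝ)) -
      ((p : ℝ) - 1) ^ 2 / p ^ (2 * j + 2)| ≤ p ^ k * (2 * mixError A (2 * k) n) := by
  have hp : p.Prime := Fact.out
  have hp0 : (0 : ℝ) < p := by exact_mod_cast hp.pos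
  have hp1 : (1 : ℝ) ≤ p := by exact_mod_cast hp.one_le
  have hδ0 := mixError_nonneg ⟨u, hu⟩ (2 * k) n
  simp only [card_unitRootsOfLevel_eq_sum, Finset.expect_sum_comm, Finset.expect_sub_distrib]
  have hmain : ((p : ℝ) - 1) ^ 2 / p ^ (2 * j + 2) = ∑ r ∈ unitResidues p (j + 1),
      (1 / (p : ℝ) ^ (2 * j + 1 + j) - 1 / (p : ℝ) ^ (2 * j + 1 + (j + 1))) := by
    rw [Finset.sum_const, card_unitResidues_succ, nsmul_eq_mul, Nat.cast_mul,
      Nat.cast_sub hp.one_le]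
    push_cast
    field_simp
    ring
  rw [hmain, ← Finset.sum_sub_distrib]
  refine (Finset.abs_sum_le_sum_abs _ _).trans ((Finset.sum_le_card_nsmul _ _
    (2 * mixError A (2 * k) n) fun r hr => ?_).trans ?_)
  · have hr' := (Finset.mem_filter.mp hr).2
    have h1 := abs_boxProb_divisibleAt_sub_le hu hv huv (α := 2 * j + 1) (β := j) (m := 2 * k)
      (by omega) (by omega) (by omega) hr' n
    have h2 := abs_boxProb_divisibleAt_sub_le hu hv huv (α := 2 * j + 1) (β := j + 1) (m := 2 * k)
      (by omega) (by omega) (by omega) hr' n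
    rw [boxProb] at h1 h2
    rw [abs_le] at h1 h2 ⊢
    constructor <;> linarith [h1.1, h1.2, h2.1, h2.2]
  · rw [nsmul_eq_mul]
    refine mul_le_mul_of_nonneg_right ?_ (by positivity)
    calc ((unitResidues p (j + 1)).card : ℝ) ≤ (p : ℝ) ^ (j + 1) := by
          exact_mod_cast card_unitResidues_le p (j + 1)
      _ ≤ (p : ℝ) ^ k := pow_le_pow_right₀ hp1 hjk

lemma expect_card_unitRootsAbove_le (hu : u ∈ A) (hv : v ∈ A) (huv : IsUnit (v - u))
    (hinj : Set.InjOn PadicInt.toZMod (A : Set ℤ_[p])) {k : ℕ} (hk : 1 ≤ k) (N n : ℕ) :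
    𝔼 a ∈ coeffBox A n, ((unitRootsAbove (monicPolyInt a) k).card : ℝ) ≤
      p * N * (p ^ k * (1 / (p : ℝ) ^ (3 * k) + mixError A (2 * k) n)) +
        n * (p * ((A.card : ℝ) ^ N)⁻¹) := by
  have hA : A.Nonempty := ⟨u, hu⟩
  have hδ0 := mixError_nonneg hA (2 * k) n
  refine (Finset.expect_le_expect fun a _ => card_unitRootsAbove_le a hk N).trans ?_
  rw [Finset.expect_add_distrib, ← Finset.mul_expect, ← Finset.mul_expect, Finset.expect_sum_comm,
    Finset.expect_sum_comm]
  refine add_le_add (mul_le_mul_of_nonneg_left ?_ (by positivity))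
    (mul_le_mul_of_nonneg_left ?_ (by positivity))
  · refine (Finset.sum_le_card_nsmul _ _ (1 / (p : ℝ) ^ (3 * k) + mixError A (2 * k) n)
      fun r hr => ?_).trans ?_
    · have h := abs_boxProb_divisibleAt_sub_le hu hv huv (α := 2 * k) (β := k) (m := 2 * k)
        le_rfl (by omega) (by omega) (Finset.mem_filter.mp hr).2 n
      rw [boxProb, show 2 * k + k = 3 * k by ring] at h
      linarith [(abs_le.mp h).2]
    · rw [nsmul_eq_mul]
      refine mul_le_mul_of_nonneg_right ?_ (by positivity)
      exact_mod_cast card_unitResidues_le p k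
  · refine (Finset.sum_le_card_nsmul _ _ (((A.card : ℝ) ^ N)⁻¹) fun c _ => ?_).trans ?_
    · have h := boxProb_dvd_map_le hA hinj ((X - C c) ^ N) n
      rwa [natDegree_pow, natDegree_X_sub_C, mul_one] at h
    · rw [nsmul_eq_mul, Finset.card_univ, ZMod.card]

lemma sum_sq_div_pow_eq {p : ℕ} (hp : 0 < p) (k : ℕ) :
    ∑ j ∈ Finset.range k, ((p : ℝ) - 1) ^ 2 / p ^ (2 * j + 2) =
      ((p : ℝ) - 1) / (p + 1) * (1 - 1 / p ^ (2 * k)) := by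
  have hp0 : (0 : ℝ) < p := by exact_mod_cast hp
  induction k with
  | zero => simp
  | succ k ih =>
    rw [Finset.sum_range_succ, ih]
    field_simp
    ring

/-- A nonasymptotic estimate for the expected number of roots, with free parameters: the level
`p ^ (2 k)` up to which the equidistribution is used, and the multiplicity `N` from which on
multiple roots modulo `p` are discarded. -/
lemma abs_expect_rootCount_sub_le [DecidableEq ℤ_[p]] (hu : u ∈ A) (hv : v ∈ A)
    (huv : IsUnit (v - u))
    (hinj : Set.InjOn PadicInt.toZMod (A : Set ℤ_[p])) (hA : ∀ x ∈ A, x = 0 ∨ IsUnit x)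
    {k : ℕ} (hk : 1 ≤ k) (N : ℕ) {n : ℕ} (hn : 1 ≤ n) :
    |(𝔼 a ∈ coeffBox A n, (rootCount (monicPoly a) : ℝ)) -
      ((𝔼 x ∈ A, if x = 0 then 1 else 0) + ((p : ℝ) - 1) / (p + 1))| ≤
      (1 + p * N) / (p : ℝ) ^ (2 * k) + (2 + p * N) * p ^ (2 * k) * mixError A (2 * k) n +
        n * (p * ((A.card : ℝ) ^ N)⁻¹) := by
  have hp : p.Prime := Fact.out
  have hp0 : (0 : ℝ) < p := by exact_mod_cast hp.pos
  have hp1 : (1 : ℝ) ≤ p := by exact_mod_cast hp.one_le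
  have hδ0 := mixError_nonneg ⟨u, hu⟩ (2 * k) n
  set δ := mixError A (2 * k) n
  have hcount : 𝔼 a ∈ coeffBox A n, (rootCount (monicPoly a) : ℝ) =
      (𝔼 x ∈ A, if x = 0 then 1 else 0) +
      (∑ j ∈ Finset.range k, 𝔼 a ∈ coeffBox A n,
        ((unitRootsOfLevel (monicPolyInt a) j).card : ℝ)) +
      𝔼 a ∈ coeffBox A n, ((unitRootsAbove (monicPolyInt a) k).card : ℝ) := by
    rw [← expect_coeffBox_apply ⟨u, hu⟩ (⟨0, hn⟩ : Fin n), ← Finset.expect_sum_comm,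
      ← Finset.expect_add_distrib, ← Finset.expect_add_distrib]
    refine Finset.expect_congr rfl fun a ha => ?_
    rw [rootCount_monicPoly_eq_add a hn fun i => hA _ (Fintype.mem_piFinset.mp ha i),
      card_unitRootsAbove_zero (monicPolyInt_monic a).ne_zero k]
    push_cast
    ring
  have hlevels : |(∑ j ∈ Finset.range k, 𝔼 a ∈ coeffBox A n,
        ((unitRootsOfLevel (monicPolyInt a) j).card : ℝ)) -
      ((p : ℝ) - 1) / (p + 1) * (1 - 1 / p ^ (2 * k))| ≤ k * (p ^ k * (2 * δ)) := by
    rw [← sum_sq_div_pow_eq hp.pos, ← Finset.sum_sub_distrib]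
    refine (Finset.abs_sum_le_sum_abs _ _).trans ((Finset.sum_le_card_nsmul _ _
      (p ^ k * (2 * δ)) fun j hj => ?_).trans (le_of_eq ?_))
    · exact abs_expect_card_unitRootsOfLevel_sub_le hu hv huv (Finset.mem_range.mp hj) n
    · rw [nsmul_eq_mul, Finset.card_range]
  have habove := expect_card_unitRootsAbove_le hu hv huv hinj hk N n
  have habove0 : 0 ≤ 𝔼 a ∈ coeffBox A n, ((unitRootsAbove (monicPolyInt a) k).card : ℝ) :=
    Finset.expect_nonneg fun _ _ => Nat.cast_nonneg _
  have hfrac0 : 0 ≤ ((p : ℝ) - 1) / (p + 1) := div_nonneg (by linarith) (by linarith)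
  have hfrac1 : ((p : ℝ) - 1) / (p + 1) ≤ 1 := by
    rw [div_le_one (by linarith)]; linarith
  have hM : (0 : ℝ) < (p : ℝ) ^ (2 * k) := by positivity
  have hloss0 : 0 ≤ ((p : ℝ) - 1) / (p + 1) * (1 / p ^ (2 * k)) := by positivity
  have hloss : ((p : ℝ) - 1) / (p + 1) * (1 / p ^ (2 * k)) ≤ 1 / (p : ℝ) ^ (2 * k) :=
    mul_le_of_le_one_left (by positivity) hfrac1
  have hkp : (k : ℝ) ≤ (p : ℝ) ^ k := by exact_mod_cast (Nat.lt_pow_self hp.one_lt).le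
  have hkk : (k : ℝ) * (p ^ k * (2 * δ)) ≤ 2 * p ^ (2 * k) * δ := by
    calc (k : ℝ) * (p ^ k * (2 * δ)) ≤ p ^ k * (p ^ k * (2 * δ)) := by gcongr
      _ = 2 * p ^ (2 * k) * δ := by ring
  have habove' : p * N * (p ^ k * (1 / (p : ℝ) ^ (3 * k) + δ)) ≤
      p * N / (p : ℝ) ^ (2 * k) + p * N * p ^ (2 * k) * δ := by
    have e1 : (p : ℝ) ^ k * (1 / (p : ℝ) ^ (3 * k)) = 1 / (p : ℝ) ^ (2 * k) := by
      rw [show 3 * k = k + 2 * k by ring, pow_add]; field_simp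
    have e2 : (p : ℝ) ^ k ≤ p ^ (2 * k) := pow_le_pow_right₀ hp1 (by omega)
    rw [mul_add, e1, mul_add, mul_one_div, mul_assoc (p * N : ℝ)]
    gcongr
  have hbn : 0 ≤ (n : ℝ) * (p * ((A.card : ℝ) ^ N)⁻¹) := by positivity
  have hpn : 0 ≤ p * N / (p : ℝ) ^ (2 * k) + p * N * p ^ (2 * k) * δ := by positivity
  have e3 : (1 + p * N) / (p : ℝ) ^ (2 * k) = 1 / (p : ℝ) ^ (2 * k) + p * N / (p : ℝ) ^ (2 * k) :=
    add_div _ _ _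
  rw [hcount, e3]
  rw [abs_le] at hlevels ⊢
  constructor <;> nlinarith [hlevels.1, hlevels.2]

end Expectation

/-! ### Choice of the parameters -/

/-- For a modulus `p ^ m` of size comparable to `n ^ (1 / 4)` the Fourier coefficients are at most
`exp (- c n ^ (1 / 4))` up to a constant, hence `O(n ^ (-1 / 2))`. -/
lemma mixError_le {A : Finset ℤ_[p]} (hA : A.Nonempty) {m n : ℕ} {x C : ℝ} (hx : 1 ≤ x)
    (hxn : x ^ 4 = n) (hC : 0 < C) (hM : ((p ^ m : ℕ) : ℝ) ≤ C * x) :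
    mixError A m n ≤ 2 * Real.exp 1 * (4 * A.card * p * C ^ 3) ^ 2 / x ^ 2 := by
  have hp : p.Prime := Fact.out
  have hq : (1 : ℝ) ≤ A.card := by exact_mod_cast hA.card_pos
  have hp1 : (1 : ℝ) ≤ p := by exact_mod_cast hp.one_le
  have hM1 : (1 : ℝ) ≤ (p ^ m : ℕ) := by exact_mod_cast Nat.pos_of_neZero (p ^ m)
  rw [mixError]
  set T := (p - 1) * p ^ m with hT
  have hT0 : 0 < T := Nat.mul_pos (Nat.sub_pos_of_lt hp.one_lt) (Nat.pos_of_neZero _)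
  have hTM : (T : ℝ) ≤ p * ((p ^ m : ℕ) : ℝ) := by
    have : T ≤ p * p ^ m := Nat.mul_le_mul_right _ (Nat.sub_le _ _)
    exact_mod_cast this
  set M : ℝ := ((p ^ m : ℕ) : ℝ)
  set t : ℝ := 1 / (4 * M ^ 2 * A.card) with ht
  have ht0 : 0 < t := by positivity
  have ht1 : t ≤ 1 := by
    rw [ht, div_le_one (by positivity)]
    nlinarith [mul_le_mul (pow_le_pow_left₀ zero_le_one hM1 2) hq zero_le_one (by positivity)]
  set y : ℝ := t * ((n / T : ℕ) : ℝ) with hy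
  have hexp : (1 - t) ^ (n / T) ≤ Real.exp (-y) := by
    rw [hy, mul_comm, ← mul_neg, Real.exp_nat_mul]
    refine pow_le_pow_left₀ (by linarith) ?_ _
    linarith [Real.add_one_le_exp (-t)]
  set c : ℝ := 1 / (4 * A.card * p * C ^ 3) with hc
  have hc0 : 0 < c := by positivity
  have hy1 : c * x ≤ y + 1 := by
    have hfl : (n : ℝ) ≤ T * (((n / T : ℕ) : ℝ) + 1) := by
      exact_mod_cast (Nat.lt_mul_div_succ n hT0).le
    have h1 : (n : ℝ) ≤ p * M * (((n / T : ℕ) : ℝ) + 1) :=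
      hfl.trans (mul_le_mul_of_nonneg_right hTM (by positivity))
    have h2 : t * (((n / T : ℕ) : ℝ) + 1) ≤ y + 1 := by rw [hy]; linarith
    refine le_trans ?_ h2
    have h3 : t * (n / (p * M)) ≤ t * (((n / T : ℕ) : ℝ) + 1) := by
      refine mul_le_mul_of_nonneg_left ?_ ht0.le
      rw [div_le_iff₀ (by positivity)]
      linarith
    refine le_trans ?_ h3
    have e1 : t * (n / (p * M)) = x ^ 4 / (4 * A.card * p * M ^ 3) := by
      rw [ht, hxn]; field_simp
    have e2 : c * x = x ^ 4 / (4 * A.card * p * (C * x) ^ 3) := by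
      rw [hc]; field_simp
    rw [e1, e2]
    gcongr
  have hz : (c * x) ^ 2 / 2 ≤ Real.exp (y + 1) := by
    have h := Real.pow_div_factorial_le_exp (c * x) (by positivity) 2
    rw [Nat.factorial_two, Nat.cast_ofNat] at h
    exact h.trans (Real.exp_le_exp.mpr hy1)
  refine hexp.trans ?_
  have e3 : 2 * Real.exp 1 * (4 * A.card * p * C ^ 3) ^ 2 / x ^ 2 =
      Real.exp 1 / ((c * x) ^ 2 / 2) := by
    rw [hc]; field_simp
  rw [e3, le_div_iff₀ (by positivity)]
  calc Real.exp (-y) * ((c * x) ^ 2 / 2) ≤ Real.exp (-y) * Real.exp (y + 1) := by gcongr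
    _ = Real.exp 1 := by rw [← Real.exp_add]; ring_nf

lemma exists_pow_le_mul_pow {q : ℝ} (hq : 1 < q) (m : ℕ) :
    ∃ B : ℝ, 0 < B ∧ ∀ N : ℕ, (N : ℝ) ^ m ≤ B * q ^ N := by
  obtain ⟨B, hB⟩ := (tendsto_pow_const_div_const_pow_of_one_lt m hq).bddAbove_range
  refine ⟨max B 1, by positivity, fun N => ?_⟩
  have h : (N : ℝ) ^ m / q ^ N ≤ B := hB ⟨N, rfl⟩
  rw [div_le_iff₀ (by positivity)] at h
  exact h.trans (mul_le_mul_of_nonneg_right (le_max_left _ _) (by positivity))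

/-- The expected number of roots for coefficients uniform on a finite set `A` of at least two
elements, each `0` or a unit, that are distinct modulo `p`. -/
lemma exists_abs_expect_rootCount_sub_le [DecidableEq ℤ_[p]] {A : Finset ℤ_[p]}
    (hcard : 2 ≤ A.card) (hinj : Set.InjOn PadicInt.toZMod (A : Set ℤ_[p]))
    (hA : ∀ x ∈ A, x = 0 ∨ IsUnit x) {ε : ℝ} (hε : 0 < ε) :
    ∃ K : ℝ, ∀ n : ℕ, 1 ≤ n →
      |(𝔼 a ∈ coeffBox A n, (rootCount (monicPoly a) : ℝ)) -
        ((𝔼 x ∈ A, if x = 0 then 1 else 0) + ((p : ℝ) - 1) / (p + 1))| ≤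
      K * (n : ℝ) ^ (-(1 / 4 : ℝ) + ε) := by
  have hp : p.Prime := Fact.out
  have hp0 : (0 : ℝ) < p := by exact_mod_cast hp.pos
  have hp1 : (1 : ℝ) ≤ p := by exact_mod_cast hp.one_le
  obtain ⟨u, hu, v, hv, huv⟩ := Finset.one_lt_card.mp hcard
  have hA0 : A.Nonempty := ⟨u, hu⟩
  have hunit : IsUnit (v - u) := by
    by_contra h
    refine huv (hinj hu hv ?_)
    have hmem : v - u ∈ RingHom.ker (PadicInt.toZMod (p := p)) := by
      rw [PadicInt.ker_toZMod]; exact (IsLocalRing.mem_maximalIdeal _).mpr h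
    rw [RingHom.mem_ker, map_sub, sub_eq_zero] at hmem
    exact hmem.symm
  have hq : (1 : ℝ) < A.card := by exact_mod_cast hcard
  obtain ⟨m, hm⟩ := exists_nat_gt (5 / 4 / ε)
  obtain ⟨B, hB0, hB⟩ := exists_pow_le_mul_pow hq m
  set D : ℝ := 2 * Real.exp 1 * (4 * A.card * p * ((p : ℝ) ^ 2) ^ 3) ^ 2 with hD
  refine ⟨(1 + 2 * p) + (2 + 2 * p) * p ^ 2 * D + p * B, fun n hn => ?_⟩
  have hn1 : (1 : ℝ) ≤ n := by exact_mod_cast hn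
  have hn0 : (0 : ℝ) < n := by linarith
  set x : ℝ := (n : ℝ) ^ (1 / 4 : ℝ) with hxdef
  have hx1 : 1 ≤ x := Real.one_le_rpow hn1 (by norm_num)
  have hx4 : x ^ 4 = n := by
    rw [hxdef, ← Real.rpow_natCast, ← Real.rpow_mul hn0.le]
    norm_num
  set z : ℝ := (n : ℝ) ^ ε with hzdef
  have hz1 : 1 ≤ z := Real.one_le_rpow hn1 hε.le
  have hgoal : (n : ℝ) ^ (-(1 / 4 : ℝ) + ε) = z / x := by
    rw [Real.rpow_add hn0, Real.rpow_neg hn0.le]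
    exact (div_eq_inv_mul _ _).symm
  -- The level is chosen so that `n ^ (1 / 4) ≤ p ^ (2 k) ≤ p ^ 2 n ^ (1 / 4)`.
  set k : ℕ := Nat.log (p ^ 8) n + 1 with hk
  have hk1 : ((p : ℝ) ^ (2 * k)) ≤ p ^ 2 * x := by
    have h : (p ^ 8) ^ Nat.log (p ^ 8) n ≤ n := Nat.pow_log_le_self _ (by omega)
    have h' : (((p : ℝ) ^ 8) ^ Nat.log (p ^ 8) n) ≤ x ^ 4 := by rw [hx4]; exact_mod_cast h
    refine le_of_pow_le_pow_left₀ (n := 4) (by norm_num) (by positivity) ?_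
    calc ((p : ℝ) ^ (2 * k)) ^ 4 = p ^ 8 * ((p : ℝ) ^ 8) ^ Nat.log (p ^ 8) n := by
          rw [hk, ← pow_mul, ← pow_mul, ← pow_add]; congr 1; ring
      _ ≤ p ^ 8 * x ^ 4 := by gcongr
      _ = (p ^ 2 * x) ^ 4 := by ring
  have hk2 : x ≤ (p : ℝ) ^ (2 * k) := by
    have h : n < (p ^ 8) ^ k := Nat.lt_pow_succ_log_self (Nat.one_lt_pow (by norm_num) hp.one_lt) n
    refine le_of_pow_le_pow_left₀ (n := 4) (by norm_num) (by positivity) ?_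
    calc x ^ 4 = n := hx4
      _ ≤ ((p : ℝ) ^ 8) ^ k := by exact_mod_cast h.le
      _ = ((p : ℝ) ^ (2 * k)) ^ 4 := by rw [← pow_mul, ← pow_mul]; congr 1; ring
  have hδ := mixError_le hA0 (m := 2 * k) hx1 hx4 (C := (p : ℝ) ^ 2) (by positivity)
    (by exact_mod_cast hk1)
  rw [← hD] at hδ
  have hδ0 := mixError_nonneg hA0 (2 * k) n
  set N : ℕ := ⌈z⌉₊ with hN
  have hN1 : z ≤ N := Nat.le_ceil z
  have hN2 : (N : ℝ) ≤ 2 * z := by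
    have := Nat.ceil_lt_add_one (by linarith : 0 ≤ z)
    linarith
  have hmain := abs_expect_rootCount_sub_le hu hv hunit hinj hA (k := k) (by omega) N hn
  refine hmain.trans ?_
  rw [hgoal, add_mul _ _ (z / x), add_mul _ _ (z / x)]
  have hD0 : 0 < D := by positivity
  refine add_le_add (add_le_add ?_ ?_) ?_
  · rw [← mul_div_assoc]
    refine div_le_div₀ (by positivity) ?_ (by positivity) hk2
    nlinarith
  · calc (2 + p * N) * (p : ℝ) ^ (2 * k) * mixError A (2 * k) n
        ≤ ((2 + 2 * p) * z) * (p ^ 2 * x) * (D / x ^ 2) := by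
          refine mul_le_mul (mul_le_mul ?_ hk1 (by positivity) (by positivity)) hδ hδ0
            (by positivity)
          nlinarith
      _ = (2 + 2 * p) * p ^ 2 * D * (z / x) := by field_simp
  · have h1 : (n : ℝ) * x ≤ B * A.card ^ N := by
      calc (n : ℝ) * x = (n : ℝ) ^ (5 / 4 : ℝ) := by
            rw [hxdef, ← Real.rpow_one_add' hn0.le (by norm_num)]; norm_num
        _ ≤ (n : ℝ) ^ (ε * m) := by
            refine Real.rpow_le_rpow_of_exponent_le hn1 ?_
            rw [div_lt_iff₀ hε] at hm
            linarith
        _ = z ^ m := by rw [hzdef, Real.rpow_mul hn0.le, Real.rpow_natCast]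
        _ ≤ (N : ℝ) ^ m := by gcongr
        _ ≤ B * A.card ^ N := hB N
    have hx0 : 0 < x := by linarith
    have hAN : (0 : ℝ) < (A.card : ℝ) ^ N := by positivity
    calc (n : ℝ) * (p * ((A.card : ℝ) ^ N)⁻¹) = p * (n * x / A.card ^ N) / x := by field_simp
      _ ≤ p * B / x := by
          gcongr
          rwa [div_le_iff₀ hAN]
      _ ≤ p * B * (z / x) := by
          rw [← mul_div_assoc]
          exact div_le_div_of_nonneg_right (le_mul_of_one_le_right (by positivity) hz1) hx0.le

/-! ### The three coefficient distributions -/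

lemma exists_abs_integral_randomRootCount_sub_le [DecidableEq ℤ_[p]] {A : Finset ℤ_[p]}
    (hcard : 2 ≤ A.card) (hinj : Set.InjOn PadicInt.toZMod (A : Set ℤ_[p]))
    (hA : ∀ x ∈ A, x = 0 ∨ IsUnit x) {ε : ℝ} (hε : 0 < ε) :
    ∃ K : ℝ, ∀ n : ℕ, 1 ≤ n →
      ∀ (Ω : Type u) [MeasurableSpace Ω] (μ : Measure Ω) [IsProbabilityMeasure μ]
        (ξ : Fin n → Ω → ℤ_[p]),
        (∀ i, Measurable (ξ i)) → iIndepFun ξ μ →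
        (∀ i, ∀ a ∈ A, μ {ω | ξ i ω = a} = (A.card : ℝ≥0∞)⁻¹) →
        Integrable (randomRootCount ξ) μ ∧
          |(∫ ω, randomRootCount ξ ω ∂μ) -
            ((𝔼 x ∈ A, if x = 0 then 1 else 0) + ((p : ℝ) - 1) / (p + 1))|
            ≤ K * (n : ℝ) ^ (-(1 / 4 : ℝ) + ε) := by
  obtain ⟨K, hK⟩ := exists_abs_expect_rootCount_sub_le hcard hinj hA hε
  refine ⟨K, fun n hn Ω _ μ _ ξ hm hind hξ => ?_⟩
  obtain ⟨h1, h2⟩ := integral_comp_eq_expect hm hind (Finset.card_pos.mp (by omega)) hξ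
    fun a => (rootCount (monicPoly a) : ℝ)
  refine ⟨h1, ?_⟩
  have h3 := hK n hn
  rw [← h2] at h3
  exact h3

lemma zmod_natCast_injOn_range : Set.InjOn (Nat.cast : ℕ → ZMod p) (Finset.range p) := by
  intro a ha b hb h
  rw [ZMod.natCast_eq_natCast_iff] at h
  exact Nat.ModEq.eq_of_lt_of_lt h (by simpa using ha) (by simpa using hb)

end

theorem corollary1p2 (p : ℕ) [Fact p.Prime] (ε : ℝ) (hε : 0 < ε) :
    -- coefficients `±1` with equal probability, `p > 2`
    (2 < p → ∃ K : ℝ, ∀ n : ℕ, 1 ≤ n →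
      ∀ (Ω : Type u) [MeasurableSpace Ω] (μ : Measure Ω) [IsProbabilityMeasure μ]
        (ξ : Fin n → Ω → ℤ_[p]),
        (∀ i, Measurable (ξ i)) → iIndepFun ξ μ →
        (∀ i, μ {ω | ξ i ω = 1} = 1 / 2 ∧ μ {ω | ξ i ω = -1} = 1 / 2) →
        Integrable (randomRootCount ξ) μ ∧
          |(∫ ω, randomRootCount ξ ω ∂μ) - ((p : ℝ) - 1) / ((p : ℝ) + 1)|
            ≤ K * (n : ℝ) ^ (-(1 / 4 : ℝ) + ε)) ∧
    -- coefficients `0` or `1` with equal probability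
    (∃ K : ℝ, ∀ n : ℕ, 1 ≤ n →
      ∀ (Ω : Type u) [MeasurableSpace Ω] (μ : Measure Ω) [IsProbabilityMeasure μ]
        (ξ : Fin n → Ω → ℤ_[p]),
        (∀ i, Measurable (ξ i)) → iIndepFun ξ μ →
        (∀ i, μ {ω | ξ i ω = 0} = 1 / 2 ∧ μ {ω | ξ i ω = 1} = 1 / 2) →
        Integrable (randomRootCount ξ) μ ∧
          |(∫ ω, randomRootCount ξ ω ∂μ) - (3 * (p : ℝ) - 1) / (2 * ((p : ℝ) + 1))|
            ≤ K * (n : ℝ) ^ (-(1 / 4 : ℝ) + ε)) ∧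
    -- coefficients uniform on `{0, …, p - 1}`
    (∃ K : ℝ, ∀ n : ℕ, 1 ≤ n →
      ∀ (Ω : Type u) [MeasurableSpace Ω] (μ : Measure Ω) [IsProbabilityMeasure μ]
        (ξ : Fin n → Ω → ℤ_[p]),
        (∀ i, Measurable (ξ i)) → iIndepFun ξ μ →
        (∀ i, ∀ a : ℕ, a < p → μ {ω | ξ i ω = (a : ℤ_[p])} = 1 / (p : ℝ≥0∞)) →
        Integrable (randomRootCount ξ) μ ∧
          |(∫ ω, randomRootCount ξ ω ∂μ) - ((p : ℝ) ^ 2 + 1) / ((p : ℝ) * ((p : ℝ) + 1))|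
            ≤ K * (n : ℝ) ^ (-(1 / 4 : ℝ) + ε)) := by
  classical
  have hp : p.Prime := Fact.out
  have hp0 : (0 : ℝ) < p := by exact_mod_cast hp.pos
  refine ⟨fun hp2 => ?_, ?_, ?_⟩
  · have hne' : (1 : ZMod p) ≠ -1 := by
      have : Fact (2 < p) := ⟨hp2⟩
      exact ZMod.neg_one_ne_one.symm
    have hne : (1 : ℤ_[p]) ≠ -1 := fun h => hne' (by simpa using congrArg PadicInt.toZMod h)
    have hcard : ({1, -1} : Finset ℤ_[p]).card = 2 := Finset.card_pair hne
    obtain ⟨K, hK⟩ := exists_abs_integral_randomRootCount_sub_le.{u} (A := {1, -1}) hcard.ge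
      (by simp [hne'])
      (by simp) hε
    have hzero : (𝔼 x ∈ ({1, -1} : Finset ℤ_[p]), if x = 0 then (1 : ℝ) else 0) = 0 :=
      Finset.expect_eq_zero (by simp)
    refine ⟨K, fun n hn Ω _ μ _ ξ hm hind hξ => ?_⟩
    have h := hK n hn Ω μ ξ hm hind (fun i a ha => by
      rw [hcard]
      rcases Finset.mem_insert.mp ha with rfl | ha
      · simpa using (hξ i).1
      · rw [Finset.mem_singleton] at ha
        subst ha
        simpa using (hξ i).2)
    rwa [hzero, zero_add] at h
  · have hcard : ({0, 1} : Finset ℤ_[p]).card = 2 := Finset.card_pair zero_ne_one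
    obtain ⟨K, hK⟩ := exists_abs_integral_randomRootCount_sub_le.{u} (A := {0, 1}) hcard.ge
      (by simp [Set.injOn_insert]) (by simp) hε
    have hzero : (𝔼 x ∈ ({0, 1} : Finset ℤ_[p]), if x = 0 then (1 : ℝ) else 0) = 1 / 2 := by
      rw [Finset.expect_eq_sum_div_card, hcard]
      simp
    refine ⟨K, fun n hn Ω _ μ _ ξ hm hind hξ => ?_⟩
    have h := hK n hn Ω μ ξ hm hind (fun i a ha => by
      rw [hcard]
      rcases Finset.mem_insert.mp ha with rfl | ha
      · simpa using (hξ i).1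
      · rw [Finset.mem_singleton] at ha
        subst ha
        simpa using (hξ i).2)
    rwa [hzero, show (1 / 2 : ℝ) + ((p : ℝ) - 1) / (p + 1) = (3 * (p : ℝ) - 1) / (2 * ((p : ℝ) + 1))
      by field_simp; ring] at h
  · have hinj : Set.InjOn (PadicInt.toZMod (p := p))
        (((Finset.range p).image (Nat.cast : ℕ → ℤ_[p]) : Finset ℤ_[p]) : Set ℤ_[p]) := by
      rw [Finset.coe_image]
      rintro _ ⟨a, ha, rfl⟩ _ ⟨b, hb, rfl⟩ h
      rw [map_natCast, map_natCast] at h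
      rw [zmod_natCast_injOn_range ha hb h]
    have hcard : ((Finset.range p).image (Nat.cast : ℕ → ℤ_[p])).card = p := by
      rw [Finset.card_image_of_injective _ Nat.cast_injective, Finset.card_range]
    obtain ⟨K, hK⟩ := exists_abs_integral_randomRootCount_sub_le.{u}
      (A := (Finset.range p).image (Nat.cast : ℕ → ℤ_[p])) (by rw [hcard]; exact hp.two_le) hinj
      (by
        intro x hx
        obtain ⟨a, ha, rfl⟩ := Finset.mem_image.mp hx
        rcases Nat.eq_zero_or_pos a with rfl | ha0
        · exact Or.inl Nat.cast_zero
        · exact Or.inr ((natCast_coprime_iff_isUnit a).mp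
            (Nat.coprime_of_lt_prime ha0.ne' (Finset.mem_range.mp ha) hp).symm)) hε
    have hzero : (𝔼 x ∈ (Finset.range p).image (Nat.cast : ℕ → ℤ_[p]),
        if x = 0 then (1 : ℝ) else 0) = 1 / p := by
      rw [Finset.expect_eq_sum_div_card, hcard, Finset.sum_ite_eq' , if_pos]
      exact Finset.mem_image.mpr ⟨0, Finset.mem_range.mpr hp.pos, Nat.cast_zero⟩
    refine ⟨K, fun n hn Ω _ μ _ ξ hm hind hξ => ?_⟩
    have h := hK n hn Ω μ ξ hm hind (fun i a ha => by
      rw [hcard]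
      obtain ⟨b, hb, rfl⟩ := Finset.mem_image.mp ha
      simpa using hξ i b (Finset.mem_range.mp hb))
    rwa [hzero, show (1 / p : ℝ) + ((p : ℝ) - 1) / (p + 1) =
      ((p : ℝ) ^ 2 + 1) / ((p : ℝ) * ((p : ℝ) + 1)) by field_simp; ring] at h
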